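/- Let $k\ge 1$ be an integer and $\rho>0$. For $\lambda\in\mathbb{R}$ let $\varphi_\lambda:[0,\infty)\to\mathbb{C}$ be the radial eigenfunction of the Laplacian of the $(k+1)$-dimensional hyperbolic space of constant sectional curvature $-1/\rho^2$ with $\varphi_\lambda(0)=1$, written as a function of the hyperbolic distance $r$ to the origin; that is, $\varphi_\lambda$ is the function that is continuous on $[0,\infty)$, of class $C^2$ on $(0,\infty)$, and satisfies $$\varphi_\lambda''(r)+\frac{k}{\rho}\coth\left(\frac r\rho\right)\varphi_\lambda'(r)+\lambda\varphi_\lambda(r)=0\quad(r>0),\qquad \varphi_\lambda(0)=1 .$$ Theorem. Fix $r>0$. As $\lambda\to+\infty$ the following hold. (A) If $k=1$, then $$\varphi_\lambda(r)=\sqrt{\frac{2}{\pi\rho\sinh(r/\rho)}}\cdot\frac{\cos(\pi/4-r\sqrt\lambda)}{\lambda^{1/4}}+o\left(\frac1{\lambda^{1/4}}\right).$$ (B) If $k=2$, then for every $\lambda>1/\rho^2$, with $b=\sqrt{\lambda\rho^2-1}$, $$\varphi_\lambda(r)=\frac{\sin(br/\rho)}{b\sinh(r/\rho)},$$ and $$\varphi_\lambda(r)=\frac{1}{\rho\sinh(r/\rho)}\cdot\frac{\sin(r\sqrt\lambda)}{\sqrt\lambda}+o\left(\frac1{\sqrt\lambda}\right).$$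 (C) If $k\ge3$, then $\varphi_\lambda(r)=o(1/\sqrt\lambda)$. (D) In particular, if $k=4$, then $$\varphi_\lambda(r)=-\left(\frac{\sqrt3}{\rho\sinh(r/\rho)}\right)^2\frac{\cos(r\sqrt\lambda)}{\lambda}+o\left(\frac1\lambda\right).$$ -/

import Mathlib

open Filter Asymptotics

noncomputable section

/-- The Laplacian of the `(k+1)`-dimensional hyperbolic space of constant sectional curvature
`-1/ρ²`, in geodesic polar coordinates and applied to a function `φ` of the distance `r > 0` to the
origin: `φ''(r) + (k/ρ) coth(r/ρ) φ'(r)`. -/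
def hyperbolicRadialLaplacian (k : ℕ) (ρ : ℝ) (φ : ℝ → ℂ) (r : ℝ) : ℂ :=
  deriv (deriv φ) r
    + (((k : ℝ) / ρ * (Real.cosh (r / ρ) / Real.sinh (r / ρ)) : ℝ) : ℂ) * deriv φ r

/-- `φ` is the radial eigenfunction `φ_lam` of the hyperbolic Laplacian: as a function of the
distance `r ∈ [0, ∞)` to the origin it is continuous, it is twice continuously differentiable on
`(0, ∞)`, it satisfies `Δφ + lam φ = 0` there, and `φ(0) = 1`. Values of `φ` at negative arguments
are irrelevant. -/
structure IsRadialEigenfunction (k : ℕ) (ρ : ℝ) (lam : ℂ) (φ : ℝ → ℂ) : Prop where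
  continuousOn : ContinuousOn φ (Set.Ici 0)
  contDiffOn : ContDiffOn ℝ 2 φ (Set.Ioi 0)
  eigen : ∀ r : ℝ, 0 < r → hyperbolicRadialLaplacian k ρ φ r + lam * φ r = 0
  map_zero : φ 0 = 1

end

/-!
In the variable `t = r / ρ` the equation becomes `f'' + k coth(t) f' + Λ f = 0` with `Λ = lam ρ²`.
For `k ≥ 1` and `Λ > 0` the energy `f' ^ 2 + Λ f ^ 2` is nonincreasing, which makes a solution
determined by its value at the origin and reduces each explicit formula to exhibiting a solution.

* `k ≥ 3`: the energy of the Liouville transform `sinh ^ (k / 2) * f` has a derivative involving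
  `f ^ 2` only. Integrating it twice, first with the crude bound `f ^ 2 ≤ f(0) ^ 2` and then with
  the bound so obtained, gives `√Λ f → 0`.
* `k = 2, 4`: in the variable `cosh t`, differentiation raises the dimension by two, so that the
  solutions come from `cos (b t)`, the solution for `k = 0` and `Λ = b ^ 2`.
* `k = 1`: with `Λ = 1 / 4 + b ^ 2`, the solution is the average over a quarter period of an even
  function of `sinh (t / 2) cos θ`. The substitution `sinh ((t - w²) / 2) = sinh (t / 2) cos θ`
  turns it into an integral of `cos (b (t - w ^ 2))` against a smooth amplitude, whose leading term
  as `b → ∞` is a Fresnel integral.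
-/

noncomputable section

open Real Set MeasureTheory
open scoped Topology

theorem tendsto_const_mul_nhdsGT_zero {c : ℝ} (hc : 0 < c) :
    Tendsto (fun x : ℝ => c * x) (𝓝[>] 0) (𝓝[>] 0) := by
  refine tendsto_nhdsWithin_iff.2 ⟨?_, ?_⟩
  · exact tendsto_nhdsWithin_of_tendsto_nhds (Continuous.tendsto' (by fun_prop) _ _ (mul_zero c))
  · filter_upwards [self_mem_nhdsWithin] with x hx using mul_pos hc hx

theorem tendsto_sinh_nhdsGT_zero : Tendsto sinh (𝓝[>] 0) (𝓝[>] 0) :=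
  tendsto_nhdsWithin_iff.2 ⟨(Continuous.tendsto' continuous_sinh _ _ sinh_zero).mono_left
    nhdsWithin_le_nhds, by filter_upwards [self_mem_nhdsWithin] with x hx using sinh_pos_iff.2 hx⟩

theorem tendsto_cosh_nhdsGT_zero : Tendsto cosh (𝓝[>] 0) (𝓝 1) :=
  (Continuous.tendsto' continuous_cosh _ _ cosh_zero).mono_left nhdsWithin_le_nhds

theorem eventually_sinh_le_two_mul : ∀ᶠ x in 𝓝[>] (0 : ℝ), sinh x ≤ 2 * x := by
  have hslope := (hasDerivAt_iff_tendsto_slope_zero.1 (hasDerivAt_sinh 0)).mono_left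
    (nhdsWithin_mono 0 fun x (hx : 0 < x) => hx.ne')
  rw [cosh_zero] at hslope
  filter_upwards [hslope.eventually (ge_mem_nhds one_lt_two), self_mem_nhdsWithin] with x hx hx0
  have hx0 : 0 < x := hx0
  simpa [inv_mul_le_iff₀ hx0, mul_comm x] using hx

theorem frequently_abs_mul_deriv_lt {f f' : ℝ → ℝ} {a ε : ℝ}
    (hd : ∀ x, 0 < x → HasDerivAt f (f' x) x) (hf : Tendsto f (𝓝[>] 0) (𝓝 a)) (hε : 0 < ε) :
    ∃ᶠ x in 𝓝[>] 0, |x * f' x| < ε := by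
  have hdouble : Tendsto (fun x : ℝ => 2 * x) (𝓝[>] 0) (𝓝[>] 0) :=
    tendsto_const_mul_nhdsGT_zero two_pos
  have hdiff : Tendsto (fun x => |f (2 * x) - f x|) (𝓝[>] 0) (𝓝 0) := by
    simpa using ((hf.comp hdouble).sub hf).abs
  refine frequently_iff.2 fun {U} hU => ?_
  obtain ⟨δ, hδ, hδU⟩ := mem_nhdsGT_iff_exists_Ioo_subset.1 hU
  obtain ⟨x, hx, hxδ⟩ := ((hdiff.eventually (gt_mem_nhds (half_pos hε))).and
    (hdouble.eventually (Ioo_mem_nhdsGT hδ))).exists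
  have hx0 : 0 < x := by linarith [hxδ.1]
  obtain ⟨ξ, ⟨hxξ, hξx⟩, hξ⟩ := exists_hasDerivAt_eq_slope f f' (show x < 2 * x by linarith)
    (fun y hy => (hd y (hx0.trans_le hy.1)).continuousAt.continuousWithinAt)
    (fun y hy => hd y (hx0.trans hy.1))
  refine ⟨ξ, hδU ⟨hx0.trans hxξ, hξx.trans hxδ.2⟩, ?_⟩
  calc |ξ * f' ξ| = ξ * (|f (2 * x) - f x| / x) := by
        rw [hξ, abs_mul, abs_div, two_mul, add_sub_cancel_right, abs_of_pos hx0,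
          abs_of_pos (hx0.trans hxξ)]
    _ ≤ 2 * x * (|f (2 * x) - f x| / x) := by gcongr
    _ = 2 * |f (2 * x) - f x| := by field_simp
    _ < ε := by linarith

/-- `f` solves the radial eigenvalue equation `f'' + k coth(t) f' + Λ f = 0` of curvature `-1` on
`(0, ∞)`, with derivative `f'`, and tends to `a` at the origin. An eigenfunction with parameters
`ρ` and `lam` becomes such a solution with `Λ = lam ρ²` in the variable `t = r / ρ`. -/
structure IsRadialSolution (k : ℕ) (Λ : ℝ) (f f' : ℝ → ℝ) (a : ℝ) : Prop where
  hasDerivAt : ∀ t : ℝ, 0 < t → HasDerivAt f (f' t) t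
  hasDerivAt_deriv : ∀ t : ℝ, 0 < t →
    HasDerivAt f' (-(k * (cosh t / sinh t)) * f' t - Λ * f t) t
  tendsto : Tendsto f (𝓝[>] 0) (𝓝 a)

namespace IsRadialSolution

variable {k : ℕ} {Λ a b t : ℝ} {f f' g g' : ℝ → ℝ}

theorem sub (hf : IsRadialSolution k Λ f f' a) (hg : IsRadialSolution k Λ g g' b) :
    IsRadialSolution k Λ (fun t => f t - g t) (fun t => f' t - g' t) (a - b) where
  hasDerivAt t ht := (hf.hasDerivAt t ht).sub (hg.hasDerivAt t ht)
  hasDerivAt_deriv t ht :=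
    ((hf.hasDerivAt_deriv t ht).sub (hg.hasDerivAt_deriv t ht)).congr_deriv (by ring)
  tendsto := hf.tendsto.sub hg.tendsto

theorem hasDerivAt_sinh_pow_mul (hf : IsRadialSolution k Λ f f' a) (ht : 0 < t) :
    HasDerivAt (fun x => sinh x ^ k * f' x) (-(Λ * sinh t ^ k * f t)) t := by
  have hs : sinh t ≠ 0 := (sinh_pos_iff.2 ht).ne'
  refine (((hasDerivAt_sinh t).fun_pow k).mul (hf.hasDerivAt_deriv t ht)).congr_deriv ?_
  cases k with
  | zero => simp
  | succ m =>
    simp only [Nat.add_sub_cancel, pow_succ]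
    field_simp
    ring

theorem frequently_abs_sinh_pow_mul_lt (hf : IsRadialSolution k Λ f f' a) (hk : 1 ≤ k) {ε : ℝ}
    (hε : 0 < ε) : ∃ᶠ x in 𝓝[>] 0, |sinh x ^ k * f' x| < ε := by
  have hsmall := (tendsto_sinh_nhdsGT_zero.mono_right nhdsWithin_le_nhds).eventually
    (ge_mem_nhds one_pos)
  refine ((frequently_abs_mul_deriv_lt hf.hasDerivAt hf.tendsto (half_pos hε)).and_eventually
    ((eventually_sinh_le_two_mul.and hsmall).and self_mem_nhdsWithin)).mono ?_
  rintro x ⟨hx, ⟨hx2, hx1⟩, hx0 : 0 < x⟩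
  have hs : 0 ≤ sinh x := (sinh_pos_iff.2 hx0).le
  rw [abs_mul, abs_of_pos hx0] at hx
  calc |sinh x ^ k * f' x| = sinh x ^ k * |f' x| := by rw [abs_mul, abs_of_nonneg (by positivity)]
    _ ≤ 2 * x * |f' x| := by
        gcongr
        exact (pow_le_of_le_one hs hx1 (by omega)).trans hx2
    _ < ε := by linarith

theorem abs_deriv_le (hf : IsRadialSolution k Λ f f' a) (hk : 1 ≤ k) (hΛ : 0 ≤ Λ) {M : ℝ}
    (ht : 0 < t) (hM : ∀ x ∈ Ioc 0 t, |f x| ≤ M) : |f' t| ≤ Λ * M * t := by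
  have hst : 0 < sinh t ^ k := pow_pos (sinh_pos_iff.2 ht) k
  have hM0 : 0 ≤ M := (abs_nonneg _).trans (hM t ⟨ht, le_rfl⟩)
  refine le_of_mul_le_mul_left (le_of_forall_pos_le_add fun ε hε => ?_) hst
  obtain ⟨s, hs, hs0, hst'⟩ := ((hf.frequently_abs_sinh_pow_mul_lt hk hε).and_eventually
    (Ioo_mem_nhdsGT ht)).exists
  have hbound : ∀ x ∈ Icc s t, ‖-(Λ * sinh x ^ k * f x)‖ ≤ Λ * sinh t ^ k * M := fun x hx => by
    have hx0 : 0 < x := hs0.trans_le hx.1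
    have : 0 ≤ sinh x := (sinh_pos_iff.2 hx0).le
    rw [norm_neg, norm_eq_abs, abs_mul, abs_of_nonneg (by positivity)]
    gcongr
    · exact sinh_le_sinh.2 hx.2
    · exact hM x ⟨hx0, hx.2⟩
  have hmvt := (convex_Icc s t).norm_image_sub_le_of_norm_hasDerivWithin_le
    (fun x hx => (hf.hasDerivAt_sinh_pow_mul (hs0.trans_le hx.1)).hasDerivWithinAt) hbound
    (left_mem_Icc.2 hst'.le) (right_mem_Icc.2 hst'.le)
  calc sinh t ^ k * |f' t| = |sinh t ^ k * f' t| := by rw [abs_mul, abs_of_pos hst]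
    _ ≤ |sinh t ^ k * f' t - sinh s ^ k * f' s| + |sinh s ^ k * f' s| := by
        simpa using abs_add_le (sinh t ^ k * f' t - sinh s ^ k * f' s) (sinh s ^ k * f' s)
    _ ≤ Λ * sinh t ^ k * M * t + ε := by
        refine add_le_add (hmvt.trans ?_) hs.le
        rw [norm_eq_abs, abs_of_pos (sub_pos.2 hst')]
        gcongr
        linarith
    _ = sinh t ^ k * (Λ * M * t) + ε := by ring

theorem tendsto_deriv (hf : IsRadialSolution k Λ f f' a) (hk : 1 ≤ k) (hΛ : 0 ≤ Λ) :
    Tendsto f' (𝓝[>] 0) (𝓝 0) := by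
  obtain ⟨δ, hδ, hδM⟩ := mem_nhdsGT_iff_exists_Ioo_subset.1
    (hf.tendsto.abs.eventually (gt_mem_nhds (lt_add_one |a|)))
  refine squeeze_zero_norm' ?_ (tendsto_nhdsWithin_of_tendsto_nhds
    (Continuous.tendsto' (f := fun x => Λ * (|a| + 1) * x) (by fun_prop) _ _ (mul_zero _)))
  filter_upwards [Ioo_mem_nhdsGT hδ] with t ht
  exact hf.abs_deriv_le hk hΛ ht.1 fun x hx => (hδM ⟨hx.1, hx.2.trans_lt ht.2⟩).le

theorem antitoneOn_energy (hf : IsRadialSolution k Λ f f' a) :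
    AntitoneOn (fun x => f' x ^ 2 + Λ * f x ^ 2) (Ioi 0) := by
  have hd : ∀ x : ℝ, 0 < x → HasDerivAt (fun x => f' x ^ 2 + Λ * f x ^ 2)
      (-(2 * k * (cosh x / sinh x) * f' x ^ 2)) x := fun x hx =>
    (((hf.hasDerivAt_deriv x hx).fun_pow 2).add
      (((hf.hasDerivAt x hx).fun_pow 2).const_mul Λ)).congr_deriv (by push_cast; ring)
  refine antitoneOn_of_hasDerivWithinAt_nonpos (convex_Ioi 0)
    (fun x hx => (hd x hx).continuousAt.continuousWithinAt)
    (fun x hx => (hd x (by simpa using hx)).hasDerivWithinAt) fun x hx => ?_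
  have hx0 : 0 < x := by simpa using hx
  have := sinh_pos_iff.2 hx0
  have := cosh_pos x
  rw [neg_nonpos]
  positivity

theorem energy_le (hf : IsRadialSolution k Λ f f' a) (hk : 1 ≤ k) (hΛ : 0 ≤ Λ) (ht : 0 < t) :
    f' t ^ 2 + Λ * f t ^ 2 ≤ Λ * a ^ 2 := by
  have hlim : Tendsto (fun x => f' x ^ 2 + Λ * f x ^ 2) (𝓝[>] 0) (𝓝 (Λ * a ^ 2)) := by
    simpa using ((hf.tendsto_deriv hk hΛ).pow 2).add ((hf.tendsto.pow 2).const_mul Λ)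
  refine ge_of_tendsto hlim ?_
  filter_upwards [Ioo_mem_nhdsGT ht] with x hx using hf.antitoneOn_energy hx.1 ht hx.2.le

theorem sq_le (hf : IsRadialSolution k Λ f f' a) (hk : 1 ≤ k) (hΛ : 0 < Λ) (ht : 0 < t) :
    f t ^ 2 ≤ a ^ 2 := by
  have := hf.energy_le hk hΛ.le ht
  refine le_of_mul_le_mul_left ?_ hΛ
  linarith [sq_nonneg (f' t)]

protected theorem unique (hf : IsRadialSolution k Λ f f' a) (hg : IsRadialSolution k Λ g g' a)
    (hk : 1 ≤ k) (hΛ : 0 < Λ) (ht : 0 < t) : f t = g t := by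
  have hsq := (hf.sub hg).sq_le hk hΛ ht
  rw [sub_self, zero_pow two_ne_zero] at hsq
  exact sub_eq_zero.1 (pow_eq_zero_iff two_ne_zero |>.1 (hsq.antisymm (sq_nonneg _)))

/-- The energy `u' ^ 2 + V u ^ 2` of the Liouville transform `u = sinh ^ (k / 2) * f` of a solution,
where `k = m + 2`. The transform satisfies `u'' + V u = 0` with
`V = Λ - (k / 2 * coth) ^ 2 + k / 2 / sinh ^ 2`, so the derivative of its energy does not involve
`f'`. -/
def liouvilleEnergy (m : ℕ) (Λ : ℝ) (f f' : ℝ → ℝ) (t : ℝ) : ℝ :=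
  sinh t ^ m * ((sinh t * f' t + (m + 2) / 2 * cosh t * f t) ^ 2 +
    (Λ * sinh t ^ 2 - ((m + 2) / 2 * cosh t) ^ 2 + (m + 2) / 2) * f t ^ 2)

variable {m : ℕ} {M s : ℝ}

theorem hasDerivAt_liouvilleEnergy (hf : IsRadialSolution (m + 2) Λ f f' a) (ht : 0 < t) :
    HasDerivAt (liouvilleEnergy m Λ f f')
      ((m + 2) / 2 * f t ^ 2 * (m * sinh t ^ (m - 1) * cosh t)) t := by
  have hs : sinh t ≠ 0 := (sinh_pos_iff.2 ht).ne'
  have hsinh := hasDerivAt_sinh t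
  have hcosh := (hasDerivAt_cosh t).const_mul ((m + 2 : ℝ) / 2)
  have hf1 := hf.hasDerivAt t ht
  have hf2 := hf.hasDerivAt_deriv t ht
  have hsq := ((hsinh.fun_mul hf2).fun_add (hcosh.fun_mul hf1)).fun_pow 2
  have hpot := ((((hsinh.fun_pow 2).const_mul Λ).fun_sub (hcosh.fun_pow 2)).add_const
    ((m + 2 : ℝ) / 2)).fun_mul (hf1.fun_pow 2)
  refine ((hsinh.fun_pow m).fun_mul (hsq.fun_add hpot)).congr_deriv ?_
  cases m with
  | zero =>
    push_cast
    field_simp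
    linear_combination -(8 * f t * f' t) * cosh_sq t
  | succ m =>
    simp only [Nat.add_sub_cancel, pow_succ]
    push_cast
    field_simp
    linear_combination -(4 * (m + 3) * sinh t * f t * f' t) * cosh_sq t

theorem tendsto_liouvilleEnergy_sub (hf : IsRadialSolution (m + 2) Λ f f' a) (hΛ : 0 ≤ Λ) :
    Tendsto (fun s => liouvilleEnergy m Λ f f' s - (m + 2) / 2 * a ^ 2 * sinh s ^ m)
      (𝓝[>] 0) (𝓝 0) := by
  have hsinh := tendsto_sinh_nhdsGT_zero.mono_right nhdsWithin_le_nhds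
  have hcosh := tendsto_cosh_nhdsGT_zero.const_mul ((m + 2 : ℝ) / 2)
  have hf' := hf.tendsto_deriv (by omega) hΛ
  have hlim := (hsinh.pow m).mul (((((hsinh.mul hf').add (hcosh.mul hf.tendsto)).pow 2).add
    (((((hsinh.pow 2).const_mul Λ).sub (hcosh.pow 2)).add_const ((m + 2 : ℝ) / 2)).mul
      (hf.tendsto.pow 2))).sub_const ((m + 2) / 2 * a ^ 2))
  refine (hlim.congr fun s => ?_).trans_eq ?_
  · simp only [liouvilleEnergy]
    ring
  · congr 1
    ring

theorem liouvilleEnergy_le_add (hf : IsRadialSolution (m + 2) Λ f f' a) (hs : 0 < s) (hst : s ≤ t)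
    (hM : ∀ x ∈ Icc s t, f x ^ 2 ≤ M) :
    liouvilleEnergy m Λ f f' t ≤
      liouvilleEnergy m Λ f f' s + (m + 2) / 2 * M * (sinh t ^ m - sinh s ^ m) := by
  have hd : ∀ x ∈ Icc s t, HasDerivAt
      (fun x => liouvilleEnergy m Λ f f' x - (m + 2) / 2 * M * sinh x ^ m)
      ((m + 2) / 2 * (f x ^ 2 - M) * (m * sinh x ^ (m - 1) * cosh x)) x := fun x hx =>
    ((hf.hasDerivAt_liouvilleEnergy (hs.trans_le hx.1)).sub
      (((hasDerivAt_sinh x).fun_pow m).const_mul _)).congr_deriv (by ring)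
  have hanti := antitoneOn_of_hasDerivWithinAt_nonpos (convex_Icc s t)
    (fun x hx => (hd x hx).continuousAt.continuousWithinAt)
    (fun x hx => (hd x (interior_subset hx)).hasDerivWithinAt) fun x hx => by
      have hx := interior_subset hx
      have hsx := sinh_pos_iff.2 (hs.trans_le hx.1)
      have := cosh_pos x
      exact mul_nonpos_of_nonpos_of_nonneg
        (mul_nonpos_of_nonneg_of_nonpos (by positivity) (sub_nonpos.2 (hM x hx))) (by positivity)
  linarith [hanti (left_mem_Icc.2 hst) (right_mem_Icc.2 hst) hst]

theorem liouvilleEnergy_le (hf : IsRadialSolution (m + 2) Λ f f' a) (hΛ : 0 < Λ) (ht : 0 < t) :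
    liouvilleEnergy m Λ f f' t ≤ (m + 2) / 2 * a ^ 2 * sinh t ^ m := by
  rw [← sub_nonpos]
  refine ge_of_tendsto (hf.tendsto_liouvilleEnergy_sub hΛ.le) ?_
  filter_upwards [Ioo_mem_nhdsGT ht] with s hs
  linarith [hf.liouvilleEnergy_le_add hs.1 hs.2.le fun x hx =>
    hf.sq_le (by omega) hΛ (hs.1.trans_le hx.1)]

theorem le_liouvilleEnergy (m : ℕ) (Λ : ℝ) (f f' : ℝ → ℝ) (ht : 0 < t) :
    sinh t ^ m * (Λ * sinh t ^ 2 - ((m + 2) / 2 * cosh t) ^ 2) * f t ^ 2 ≤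
      liouvilleEnergy m Λ f f' t := by
  have := sinh_pos_iff.2 ht
  rw [liouvilleEnergy, mul_assoc]
  gcongr
  have : 0 ≤ (sinh t * f' t + (m + 2) / 2 * cosh t * f t) ^ 2 + (m + 2) / 2 * f t ^ 2 := by
    positivity
  linarith

theorem mul_sinh_sq_mul_sq_le (hf : IsRadialSolution (m + 2) Λ f f' a) (hΛ : 0 < Λ) (ht : 0 < t) :
    Λ * sinh t ^ 2 * f t ^ 2 ≤ ((m + 2) / 2 + ((m + 2) / 2 * cosh t) ^ 2) * a ^ 2 := by
  have hs := sinh_pos_iff.2 ht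
  have hle : (Λ * sinh t ^ 2 - ((m + 2) / 2 * cosh t) ^ 2) * f t ^ 2 ≤ (m + 2) / 2 * a ^ 2 := by
    refine le_of_mul_le_mul_left ?_ (pow_pos hs m)
    linarith [(le_liouvilleEnergy m Λ f f' ht).trans (hf.liouvilleEnergy_le hΛ ht)]
  have := mul_le_mul_of_nonneg_left (hf.sq_le (by omega) hΛ ht)
    (sq_nonneg ((m + 2) / 2 * cosh t : ℝ))
  linarith

theorem sq_le_div_mul_sinh_sq (hf : IsRadialSolution (m + 2) Λ f f' a) (hΛ : 0 < Λ) (hs : 0 < s)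
    {x : ℝ} (hx : x ∈ Icc s t) :
    f x ^ 2 ≤ ((m + 2) / 2 + ((m + 2) / 2 * cosh t) ^ 2) * a ^ 2 / (Λ * sinh s ^ 2) := by
  have := sinh_pos_iff.2 hs
  have hx0 := hs.trans_le hx.1
  rw [le_div_iff₀ (by positivity)]
  calc f x ^ 2 * (Λ * sinh s ^ 2) ≤ Λ * sinh x ^ 2 * f x ^ 2 := by
        rw [mul_comm]
        gcongr
        exact sinh_le_sinh.2 hx.1
    _ ≤ ((m + 2) / 2 + ((m + 2) / 2 * cosh x) ^ 2) * a ^ 2 := hf.mul_sinh_sq_mul_sq_le hΛ hx0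
    _ ≤ ((m + 2) / 2 + ((m + 2) / 2 * cosh t) ^ 2) * a ^ 2 := by
        gcongr ((m + 2) / 2 + ((m + 2) / 2 * ?_) ^ 2) * a ^ 2
        exact cosh_le_cosh.2 (abs_le_abs_of_nonneg hx0.le hx.2)

/-- The interval `(0, s]`, where only `f ^ 2 ≤ a ^ 2` is known, contributes little to the energy
when `s` is small, while on `[s, t]` the previous bound shows that `f ^ 2` is of order `1 / Λ`. -/
theorem mul_sinh_pow_mul_sq_le (hf : IsRadialSolution (m + 2) Λ f f' a) (hΛ : 0 < Λ) (hs : 0 < s)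
    (hst : s ≤ t) {C : ℝ} (hC : C = (m + 2) / 2 + ((m + 2) / 2 * cosh t) ^ 2) :
    Λ * sinh t ^ (m + 2) * f t ^ 2 ≤
      ((m + 2) / 2 * sinh s ^ m + sinh t ^ m * C ^ 2 / (Λ * sinh s ^ 2)) * a ^ 2 := by
  set M := C * a ^ 2 / (Λ * sinh s ^ 2) with hMdef
  have hM : ∀ x ∈ Icc s t, f x ^ 2 ≤ M := fun x hx => by
    rw [hMdef, hC]
    exact hf.sq_le_div_mul_sinh_sq hΛ hs hx
  have hM0 : 0 ≤ (m + 2) / 2 * M * sinh s ^ m := by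
    have := sinh_pos_iff.2 hs
    rw [hMdef, hC]
    positivity
  have hft : sinh t ^ m * (((m + 2) / 2 * cosh t) ^ 2 * f t ^ 2) ≤
      sinh t ^ m * (((m + 2) / 2 * cosh t) ^ 2 * M) := by
    have := sinh_pos_iff.2 (hs.trans_le hst)
    have := hM t (right_mem_Icc.2 hst)
    gcongr
  calc Λ * sinh t ^ (m + 2) * f t ^ 2
      = sinh t ^ m * (Λ * sinh t ^ 2 - ((m + 2) / 2 * cosh t) ^ 2) * f t ^ 2 +
          sinh t ^ m * (((m + 2) / 2 * cosh t) ^ 2 * f t ^ 2) := by ring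
    _ ≤ (m + 2) / 2 * a ^ 2 * sinh s ^ m + (m + 2) / 2 * M * (sinh t ^ m - sinh s ^ m) +
          sinh t ^ m * (((m + 2) / 2 * cosh t) ^ 2 * M) := by
        linarith [le_liouvilleEnergy m Λ f f' (hs.trans_le hst),
          hf.liouvilleEnergy_le_add hs hst hM, hf.liouvilleEnergy_le hΛ hs]
    _ ≤ (m + 2) / 2 * a ^ 2 * sinh s ^ m + sinh t ^ m * C * M := by
        rw [hC]
        linarith
    _ = ((m + 2) / 2 * sinh s ^ m + sinh t ^ m * C ^ 2 / (Λ * sinh s ^ 2)) * a ^ 2 := by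
        rw [hMdef]
        ring

theorem tendsto_sqrt_mul {f f' : ℝ → ℝ → ℝ}
    (hf : ∀ Λ, 0 < Λ → IsRadialSolution (m + 2) Λ (f Λ) (f' Λ) a) (hm : m ≠ 0) (ht : 0 < t) :
    Tendsto (fun Λ => √Λ * f Λ t) atTop (𝓝 0) := by
  have hst := sinh_pos_iff.2 ht
  set C : ℝ := (m + 2) / 2 + ((m + 2) / 2 * cosh t) ^ 2 with hC
  have hsqrt : Tendsto (fun Λ : ℝ => (√Λ)⁻¹) atTop (𝓝 0) := tendsto_sqrt_atTop.inv_tendsto_atTop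
  have hσ : Tendsto (fun Λ : ℝ => (√(√Λ))⁻¹) atTop (𝓝 0) :=
    (tendsto_sqrt_atTop.comp tendsto_sqrt_atTop).inv_tendsto_atTop
  have hlim : Tendsto (fun Λ : ℝ => ((m + 2) / 2 * (√(√Λ))⁻¹ ^ m + sinh t ^ m * C ^ 2 * (√Λ)⁻¹) *
      a ^ 2 / sinh t ^ (m + 2)) atTop (𝓝 0) := by
    simpa [hm] using ((((hσ.pow m).const_mul ((m + 2 : ℝ) / 2)).add
      (hsqrt.const_mul (sinh t ^ m * C ^ 2))).mul_const (a ^ 2)).div_const (sinh t ^ (m + 2))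
  have hsq : Tendsto (fun Λ => Λ * f Λ t ^ 2) atTop (𝓝 0) := by
    refine squeeze_zero' ?_ ?_ hlim
    · filter_upwards [eventually_gt_atTop 0] with Λ hΛ using by positivity
    filter_upwards [eventually_gt_atTop 0, hσ.eventually (ge_mem_nhds hst)] with Λ hΛ hΛt
    have hs0 : 0 < arsinh (√(√Λ))⁻¹ := arsinh_pos_iff.2 (by positivity)
    have hst' : arsinh (√(√Λ))⁻¹ ≤ t := by rwa [← sinh_le_sinh, sinh_arsinh]
    have hdiv : sinh t ^ m * C ^ 2 / (Λ * (√Λ)⁻¹) = sinh t ^ m * C ^ 2 * (√Λ)⁻¹ := by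
      rw [← div_eq_mul_inv, div_sqrt, div_eq_mul_inv]
    have hle := (hf Λ hΛ).mul_sinh_pow_mul_sq_le hΛ hs0 hst' hC
    rw [sinh_arsinh, inv_pow _ 2, sq_sqrt (sqrt_nonneg Λ), hdiv] at hle
    rw [le_div_iff₀ (by positivity)]
    linarith
  refine (tendsto_zero_iff_abs_tendsto_zero _).2 ?_
  rw [← sqrt_zero]
  refine hsq.sqrt.congr' ?_
  filter_upwards [eventually_gt_atTop 0] with Λ hΛ
  rw [sqrt_mul hΛ.le, sqrt_sq_eq_abs, Function.comp_apply, abs_mul, abs_of_nonneg (sqrt_nonneg Λ)]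

theorem tendsto_deriv_div_sinh (hf : IsRadialSolution k Λ f f' a)
    (hf' : Tendsto f' (𝓝[>] 0) (𝓝 0)) :
    Tendsto (fun x => f' x / sinh x) (𝓝[>] 0) (𝓝 (-(Λ * a) / (k + 1))) := by
  have hsinh := tendsto_sinh_nhdsGT_zero.mono_right nhdsWithin_le_nhds
  have hlim : Tendsto (fun x => -(Λ * f x) / ((k + 1) * cosh x)) (𝓝[>] 0)
      (𝓝 (-(Λ * a) / ((k + 1) * 1))) :=
    (hf.tendsto.const_mul Λ).neg.div (tendsto_cosh_nhdsGT_zero.const_mul _) (by positivity)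
  rw [mul_one] at hlim
  have hquot : Tendsto (fun x => sinh x ^ k * f' x / sinh x ^ (k + 1)) (𝓝[>] 0)
      (𝓝 (-(Λ * a) / (k + 1))) := by
    refine HasDerivAt.lhopital_zero_nhdsGT
      (f' := fun x => -(Λ * sinh x ^ k * f x)) (g' := fun x => (k + 1) * sinh x ^ k * cosh x)
      ?_ ?_ ?_ ?_ ?_ (hlim.congr' ?_)
    · filter_upwards [self_mem_nhdsWithin] with x hx using hf.hasDerivAt_sinh_pow_mul hx
    · refine Eventually.of_forall fun x => ((hasDerivAt_sinh x).fun_pow (k + 1)).congr_deriv ?_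
      push_cast
      rfl
    · filter_upwards [self_mem_nhdsWithin] with x hx
      have := sinh_pos_iff.2 hx
      have := cosh_pos x
      positivity
    · simpa using (hsinh.pow k).mul hf'
    · simpa using hsinh.pow (k + 1)
    · filter_upwards [self_mem_nhdsWithin] with x hx
      have := (sinh_pos_iff.2 hx).ne'
      have := (cosh_pos x).ne'
      field_simp
  refine hquot.congr' ?_
  filter_upwards [self_mem_nhdsWithin] with x hx
  rw [pow_succ, mul_div_mul_left _ _ (pow_ne_zero k (sinh_pos_iff.2 hx).ne')]

/-- In the variable `cosh t` the passage from `f` to `f' / sinh` is differentiation, which raises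
the dimension of the hyperbolic space by two. -/
theorem deriv_div_sinh (hf : IsRadialSolution k Λ f f' a) (hf' : Tendsto f' (𝓝[>] 0) (𝓝 0))
    (hΛ : Λ ≠ 0) : IsRadialSolution (k + 2) (Λ + k + 1) (fun t => -((k + 1) / Λ) * (f' t / sinh t))
      (fun t => (k + 1) / Λ * (((k + 1) * cosh t * f' t + Λ * sinh t * f t) / sinh t ^ 2)) a where
  hasDerivAt t ht := by
    have hs := (sinh_pos_iff.2 ht).ne'
    refine (((hf.hasDerivAt_deriv t ht).fun_div (hasDerivAt_sinh t) hs).const_mul _).congr_deriv ?_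
    field_simp
    ring
  hasDerivAt_deriv t ht := by
    have hs := (sinh_pos_iff.2 ht).ne'
    refine ((((((hasDerivAt_cosh t).const_mul ((k : ℝ) + 1)).fun_mul
      (hf.hasDerivAt_deriv t ht)).fun_add
      (((hasDerivAt_sinh t).const_mul Λ).fun_mul (hf.hasDerivAt t ht))).fun_div
      ((hasDerivAt_sinh t).fun_pow 2) (pow_ne_zero 2 hs)).const_mul _).congr_deriv ?_
    push_cast
    field_simp
    ring
  tendsto := by
    convert (hf.tendsto_deriv_div_sinh hf').const_mul (-((k + 1) / Λ)) using 2
    field_simp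

end IsRadialSolution

theorem isRadialSolution_zero (b : ℝ) :
    IsRadialSolution 0 (b ^ 2) (fun t => cos (b * t)) (fun t => -(b * sin (b * t))) 1 where
  hasDerivAt t _ := ((hasDerivAt_id t).const_mul b).cos.congr_deriv (by simp [mul_comm])
  hasDerivAt_deriv t _ :=
    (((hasDerivAt_id t).const_mul b).sin.const_mul b).neg.congr_deriv (by simp; ring)
  tendsto := tendsto_nhdsWithin_of_tendsto_nhds
    (Continuous.tendsto' (by fun_prop) _ _ (by simp))

theorem isRadialSolution_two {b : ℝ} (hb : b ≠ 0) :
    IsRadialSolution 2 (1 + b ^ 2) (fun t => sin (b * t) / (b * sinh t))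
      (fun t => (b * cos (b * t) * sinh t - sin (b * t) * cosh t) / (b * sinh t ^ 2)) 1 := by
  have hlim : Tendsto (fun t => -(b * sin (b * t))) (𝓝[>] 0) (𝓝 0) :=
    tendsto_nhdsWithin_of_tendsto_nhds (Continuous.tendsto' (by fun_prop) _ _ (by simp))
  convert (isRadialSolution_zero b).deriv_div_sinh hlim (by positivity) using 1
  · push_cast
    ring
  · funext t
    push_cast
    field_simp
    ring
  · funext t
    push_cast
    field_simp
    ring

theorem isRadialSolution_four {b : ℝ} (hb : b ≠ 0) :
    ∃ f', IsRadialSolution 4 (4 + b ^ 2) (fun t => 3 * (sin (b * t) * cosh t -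
      b * cos (b * t) * sinh t) / (b * (1 + b ^ 2) * sinh t ^ 3)) f' 1 := by
  have htwo := isRadialSolution_two hb
  obtain ⟨f', hfour⟩ : ∃ f', IsRadialSolution (2 + 2) _ _ f' 1 :=
    ⟨_, htwo.deriv_div_sinh (htwo.tendsto_deriv one_le_two (by positivity)) (by positivity)⟩
  refine ⟨f', ?_⟩
  convert hfour using 1
  · push_cast
    ring
  · funext t
    push_cast
    field_simp
    ring

theorem hasDerivAt_intervalIntegral_of_continuous {E : Type*} [NormedAddCommGroup E]
    [NormedSpace ℝ E] {F F' : ℝ → ℝ → E} (hF : Continuous F.uncurry) (hF' : Continuous F'.uncurry)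
    (hd : ∀ x θ, HasDerivAt (fun y => F y θ) (F' x θ) x) (a b x : ℝ) :
    HasDerivAt (fun y => ∫ θ in a..b, F y θ) (∫ θ in a..b, F' x θ) x := by
  obtain ⟨C, hC⟩ := (isCompact_Icc (a := x - 1) (b := x + 1)).prod
    (isCompact_uIcc (a := a) (b := b)) |>.exists_bound_of_continuousOn hF'.continuousOn
  exact (intervalIntegral.hasDerivAt_integral_of_dominated_loc_of_deriv_le (bound := fun _ => C)
    (Icc_mem_nhds (sub_one_lt x) (lt_add_one x))
    (Eventually.of_forall fun y => (hF.uncurry_left y).aestronglyMeasurable)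
    ((hF.uncurry_left x).intervalIntegrable a b) (hF'.uncurry_left x).aestronglyMeasurable
    (Eventually.of_forall fun θ hθ y hy => hC (y, θ) ⟨hy, uIoc_subset_uIcc hθ⟩)
    intervalIntegrable_const (Eventually.of_forall fun θ _ y _ => hd y θ)).2

/-- The moments `∫ cos θ ^ n * G (x * cos θ)` over a quarter period. For `x = sinh (t / 2)` and
`n = 0` they superpose even functions of `x` into radial functions on the hyperbolic plane. -/
def cosMoment (n : ℕ) (G : ℝ → ℝ) (x : ℝ) : ℝ :=
  ∫ θ in 0..π / 2, cos θ ^ n * G (x * cos θ)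

section CosMoment

variable {G G' G'' : ℝ → ℝ} {Λ : ℝ}

theorem hasDerivAt_cosMoment (hG' : Continuous G') (hd : ∀ y, HasDerivAt G (G' y) y)
    (n : ℕ) (x : ℝ) : HasDerivAt (cosMoment n G) (cosMoment (n + 1) G' x) x := by
  have hG : Continuous G := continuous_iff_continuousAt.2 fun y => (hd y).continuousAt
  refine hasDerivAt_intervalIntegral_of_continuous (F := fun y θ => cos θ ^ n * G (y * cos θ))
    (F' := fun y θ => cos θ ^ (n + 1) * G' (y * cos θ)) ?_ ?_ (fun y θ => ?_) _ _ x
  · unfold Function.uncurry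
    fun_prop
  · unfold Function.uncurry
    fun_prop
  · refine (((hd _).comp y ((hasDerivAt_id y).mul_const (cos θ))).const_mul _).congr_deriv ?_
    simp only [id]
    ring

theorem cosMoment_ode (hd : ∀ y, HasDerivAt G (G' y) y) (hd' : ∀ y, HasDerivAt G' (G'' y) y)
    (hG'' : Continuous G'') (h0 : G' 0 = 0)
    (hode : ∀ y, (1 + y ^ 2) * G'' y + 3 * y * G' y + 4 * Λ * G y = 0) (x : ℝ) :
    x * (1 + x ^ 2) * cosMoment 2 G'' x + (1 + 3 * x ^ 2) * cosMoment 1 G' x +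
      4 * Λ * x * cosMoment 0 G x = 0 := by
  have hG : Continuous G := continuous_iff_continuousAt.2 fun y => (hd y).continuousAt
  have hG' : Continuous G' := continuous_iff_continuousAt.2 fun y => (hd' y).continuousAt
  have hderiv : ∀ θ ∈ uIcc 0 (π / 2), HasDerivAt (fun θ => sin θ * G' (x * cos θ))
      (x * (1 + x ^ 2) * (cos θ ^ 2 * G'' (x * cos θ)) +
        (1 + 3 * x ^ 2) * (cos θ ^ 1 * G' (x * cos θ)) +
        4 * Λ * x * (cos θ ^ 0 * G (x * cos θ))) θ := fun θ _ => by
    refine ((hasDerivAt_sin θ).fun_mul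
      ((hd' _).comp θ ((hasDerivAt_cos θ).const_mul x))).congr_deriv ?_
    simp only [Function.comp_apply]
    linear_combination -x * hode (x * cos θ) - x * G'' (x * cos θ) * sin_sq_add_cos_sq θ
  have hint : ∀ {H : ℝ → ℝ} (n : ℕ), Continuous H →
      IntervalIntegrable (fun θ => cos θ ^ n * H (x * cos θ)) volume 0 (π / 2) := fun n hH =>
    Continuous.intervalIntegrable (by fun_prop) _ _
  have h2 := (hint 2 hG'').const_mul (x * (1 + x ^ 2))
  have h1 := (hint 1 hG').const_mul (1 + 3 * x ^ 2)
  have hzero := (hint 0 hG).const_mul (4 * Λ * x)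
  have hFTC := intervalIntegral.integral_eq_sub_of_hasDerivAt hderiv ((h2.add h1).add hzero)
  rw [intervalIntegral.integral_add (h2.add h1) hzero, intervalIntegral.integral_add h2 h1] at hFTC
  simp only [intervalIntegral.integral_const_mul] at hFTC
  simpa [h0, cosMoment] using hFTC

theorem isRadialSolution_cosMoment (hd : ∀ y, HasDerivAt G (G' y) y)
    (hd' : ∀ y, HasDerivAt G' (G'' y) y) (hG'' : Continuous G'') (h0 : G' 0 = 0)
    (hode : ∀ y, (1 + y ^ 2) * G'' y + 3 * y * G' y + 4 * Λ * G y = 0) :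
    IsRadialSolution 1 Λ (fun t => 2 / π * cosMoment 0 G (sinh (t / 2)))
      (fun t => 2 / π * (cosh (t / 2) / 2 * cosMoment 1 G' (sinh (t / 2)))) (G 0) := by
  have hG' : Continuous G' := continuous_iff_continuousAt.2 fun y => (hd' y).continuousAt
  have hhalf (t : ℝ) : HasDerivAt (fun t : ℝ => t / 2) (1 / 2) t := (hasDerivAt_id t).div_const 2
  have hderiv (t : ℝ) : HasDerivAt (fun t => 2 / π * cosMoment 0 G (sinh (t / 2)))
      (2 / π * (cosh (t / 2) / 2 * cosMoment 1 G' (sinh (t / 2)))) t :=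
    (((hasDerivAt_cosMoment hG' hd 0 _).comp t (hhalf t).sinh).const_mul _).congr_deriv (by ring)
  refine ⟨fun t _ => hderiv t, fun t ht => ?_, ?_⟩
  · refine ((((hhalf t).cosh.div_const 2).fun_mul
      ((hasDerivAt_cosMoment hG'' hd' 1 _).comp t (hhalf t).sinh)).const_mul _).congr_deriv ?_
    have hs := (sinh_pos_iff.2 (half_pos ht)).ne'
    have hc := (cosh_pos (t / 2)).ne'
    have hsinh : sinh t = 2 * sinh (t / 2) * cosh (t / 2) := by rw [← sinh_two_mul]; ring_nf
    have hcosh : cosh t = 1 + 2 * sinh (t / 2) ^ 2 := by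
      rw [← mul_div_cancel₀ t two_ne_zero, cosh_two_mul, cosh_sq]; ring_nf
    rw [hsinh, hcosh]
    push_cast
    field_simp
    simp only [Function.comp_apply]
    linear_combination cosMoment_ode hd hd' hG'' h0 hode (sinh (t / 2)) +
      sinh (t / 2) * cosMoment 2 G'' (sinh (t / 2)) * cosh_sq (t / 2)
  · have hcont := (hderiv 0).continuousAt.tendsto
    have hat : 2 / π * cosMoment 0 G (sinh (0 / 2)) = G 0 := by
      rw [zero_div, sinh_zero, cosMoment]
      simp only [pow_zero, one_mul, zero_mul, intervalIntegral.integral_const, sub_zero,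
        smul_eq_mul]
      field_simp
    rw [hat] at hcont
    exact tendsto_nhdsWithin_of_tendsto_nhds hcont

end CosMoment

/-- The even solution of `(1 + y²) G'' + 3 y G' + (1 + 4 b²) G = 0` with value `1` at `0`. -/
def planeKernel (b y : ℝ) : ℝ :=
  cos (2 * b * arsinh y) / √(1 + y ^ 2)

theorem hasDerivAt_sqrt_one_add_sq (y : ℝ) :
    HasDerivAt (fun y : ℝ => √(1 + y ^ 2)) (y / √(1 + y ^ 2)) y := by
  refine (((hasDerivAt_pow 2 y).const_add 1).sqrt (by positivity)).congr_deriv ?_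
  push_cast
  field_simp

theorem hasDerivAt_planeKernel (b y : ℝ) : HasDerivAt (planeKernel b)
    (-(2 * b * sin (2 * b * arsinh y) + y * planeKernel b y) / (1 + y ^ 2)) y := by
  have hpos : √(1 + y ^ 2) ≠ 0 := (sqrt_pos.2 (by positivity)).ne'
  have hsq : √(1 + y ^ 2) ^ 2 = 1 + y ^ 2 := sq_sqrt (by positivity)
  refine (((hasDerivAt_arsinh y).const_mul (2 * b)).cos.fun_div (hasDerivAt_sqrt_one_add_sq y)
    hpos).congr_deriv ?_
  rw [planeKernel, hsq]
  congr 1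
  field_simp
  ring

theorem hasDerivAt_deriv_planeKernel (b y : ℝ) : HasDerivAt
    (fun y => -(2 * b * sin (2 * b * arsinh y) + y * planeKernel b y) / (1 + y ^ 2))
    (-(3 * y * (-(2 * b * sin (2 * b * arsinh y) + y * planeKernel b y) / (1 + y ^ 2)) +
      (1 + 4 * b ^ 2) * planeKernel b y) / (1 + y ^ 2)) y := by
  have hone : 1 + y ^ 2 ≠ 0 := by positivity
  have hsin : HasDerivAt (fun y => 2 * b * sin (2 * b * arsinh y))
      (4 * b ^ 2 * planeKernel b y) y :=
    (((hasDerivAt_arsinh y).const_mul (2 * b)).sin.const_mul (2 * b)).congr_deriv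
      (by rw [planeKernel]; ring)
  refine ((hsin.fun_add ((hasDerivAt_id' y).fun_mul (hasDerivAt_planeKernel b y))).fun_neg.fun_div
    ((hasDerivAt_pow 2 y).const_add 1) hone).congr_deriv ?_
  push_cast
  field_simp
  ring

theorem planeKernel_sinh_mul_cosh (b x : ℝ) :
    planeKernel b (sinh x) * cosh x = cos (2 * b * x) := by
  rw [planeKernel, arsinh_sinh, add_comm, ← cosh_sq, sqrt_sq (cosh_pos x).le,
    div_mul_cancel₀ _ (cosh_pos x).ne']

theorem isRadialSolution_one (b : ℝ) :
    ∃ f', IsRadialSolution 1 (1 / 4 + b ^ 2)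
      (fun t => 2 / π * cosMoment 0 (planeKernel b) (sinh (t / 2))) f' 1 := by
  have hone (y : ℝ) : 1 + y ^ 2 ≠ 0 := by positivity
  have hcont : Continuous (planeKernel b) :=
    continuous_iff_continuousAt.2 fun y => (hasDerivAt_planeKernel b y).continuousAt
  have hsol := isRadialSolution_cosMoment (Λ := 1 / 4 + b ^ 2) (hasDerivAt_planeKernel b)
    (hasDerivAt_deriv_planeKernel b)
    (by have := continuous_arsinh; fun_prop (disch := exact hone _)) (by simp)
    (fun y => by have := hone y; field_simp; ring)
  exact ⟨_, by simpa only [planeKernel, arsinh_zero, mul_zero, cos_zero, ne_eq, OfNat.ofNat_ne_zero,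
    not_false_eq_true, zero_pow, add_zero, sqrt_one, div_one] using hsol⟩

theorem intervalIntegrable_deriv_of_nonpos {p p' : ℝ → ℝ} {R S : ℝ}
    (hp : ∀ u ∈ uIcc R S, HasDerivAt p (p' u) u) (hp' : ∀ u ∈ uIcc R S, p' u ≤ 0) :
    IntervalIntegrable p' volume R S := by
  have hneg := intervalIntegral.intervalIntegrable_deriv_of_nonneg
    (g := fun u => -p u) (g' := fun u => -p' u)
    (fun u hu => (hp u hu).fun_neg.continuousAt.continuousWithinAt)
    (fun u hu => (hp u (Ioo_subset_Icc_self hu)).fun_neg)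
    (fun u hu => neg_nonneg.2 (hp' u (Ioo_subset_Icc_self hu)))
  simpa only [Pi.neg_def, neg_neg] using hneg.neg

/-- By integration by parts only bounds on `v` enter, not on `v'`, so that oscillating integrals
which do not converge absolutely can be estimated. -/
theorem norm_integral_smul_deriv_le {E : Type*} [NormedAddCommGroup E] [NormedSpace ℝ E]
    [CompleteSpace E] {p p' : ℝ → ℝ} {v v' : ℝ → E} {R S B : ℝ} (hRS : R ≤ S)
    (hp : ∀ u ∈ Icc R S, HasDerivAt p (p' u) u) (hp' : ∀ u ∈ Icc R S, p' u ≤ 0) (hpS : 0 ≤ p S)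
    (hv : ∀ u ∈ Icc R S, HasDerivAt v (v' u) u) (hv' : IntervalIntegrable v' volume R S)
    (hB : ∀ u ∈ Icc R S, ‖v u‖ ≤ B) : ‖∫ u in R..S, p u • v' u‖ ≤ 2 * (B * p R) := by
  rw [← uIcc_of_le hRS] at hp hp' hv
  have hp'i := intervalIntegrable_deriv_of_nonpos hp hp'
  have hpR : p R = p S + ∫ u in R..S, -p' u := by
    rw [intervalIntegral.integral_neg, intervalIntegral.integral_eq_sub_of_hasDerivAt hp hp'i]
    ring
  have hrest : ‖∫ u in R..S, p' u • v u‖ ≤ B * ∫ u in R..S, -p' u := by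
    rw [← intervalIntegral.integral_const_mul]
    refine intervalIntegral.norm_integral_le_of_norm_le hRS (ae_of_all _ fun u hu => ?_)
      (hp'i.neg.const_mul B)
    have huI := Ioc_subset_Icc_self hu
    rw [norm_smul, Real.norm_of_nonpos (hp' u (Icc_subset_uIcc huI)), mul_comm]
    exact mul_le_mul_of_nonneg_right (hB u huI) (neg_nonneg.2 (hp' u (Icc_subset_uIcc huI)))
  have hvR := hB R (left_mem_Icc.2 hRS)
  have hvS := hB S (right_mem_Icc.2 hRS)
  have hpR0 : 0 ≤ p R := by
    rw [hpR]
    exact add_nonneg hpS (intervalIntegral.integral_nonneg hRS fun u hu =>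
      neg_nonneg.2 (hp' u (Icc_subset_uIcc hu)))
  rw [intervalIntegral.integral_smul_deriv_eq_deriv_smul hp hv hp'i hv']
  calc ‖p S • v S - p R • v R - ∫ u in R..S, p' u • v u‖
      ≤ p S * ‖v S‖ + p R * ‖v R‖ + ‖∫ u in R..S, p' u • v u‖ := by
        refine (norm_sub_le _ _).trans (add_le_add_left ((norm_sub_le _ _).trans_eq ?_) _)
        rw [norm_smul, norm_smul, Real.norm_of_nonneg hpS, Real.norm_of_nonneg hpR0]
    _ ≤ p S * B + p R * B + B * ∫ u in R..S, -p' u := by gcongr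
    _ = 2 * (B * p R) := by rw [hpR]; ring

section Gaussian

variable {c : ℂ}

theorem norm_cexp_neg_mul_sq_le (hre : 0 ≤ c.re) (u : ℝ) :
    ‖Complex.exp (-c * (u : ℂ) ^ 2)‖ ≤ 1 := by
  rw [Complex.norm_exp, ← Complex.ofReal_pow, Complex.re_mul_ofReal, Complex.neg_re]
  exact exp_le_one_iff.2 (by nlinarith [sq_nonneg u])

theorem continuous_cexp_neg_mul_sq (c : ℂ) :
    Continuous fun u : ℝ => Complex.exp (-c * (u : ℂ) ^ 2) := by
  fun_prop

theorem norm_integral_cexp_neg_mul_sq_le (hre : 0 ≤ c.re) (hc : c ≠ 0) {R S : ℝ} (hR : 0 < R)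
    (hRS : R ≤ S) : ‖∫ u in R..S, Complex.exp (-c * (u : ℂ) ^ 2)‖ ≤ 1 / (‖c‖ * R) := by
  have hpos : ∀ u ∈ Icc R S, u ≠ 0 := fun u hu => (hR.trans_le hu.1).ne'
  have hp : ∀ u ∈ Icc R S, HasDerivAt (fun u : ℝ => 1 / (2 * u)) (-(1 / (2 * u ^ 2))) u :=
    fun u hu => by
      have := hpos u hu
      refine ((hasDerivAt_const u (1 : ℝ)).fun_div ((hasDerivAt_id' u).const_mul 2)
        (by positivity)).congr_deriv ?_
      field_simp
      ring
  have hv (u : ℝ) : HasDerivAt (fun u : ℝ => -Complex.exp (-c * (u : ℂ) ^ 2) / c)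
      (2 * u * Complex.exp (-c * (u : ℂ) ^ 2)) u := by
    refine ((((hasDerivAt_pow 2 (u : ℂ)).const_mul (-c)).cexp.fun_neg.div_const c).congr_deriv
      ?_).comp_ofReal
    push_cast
    field_simp
  have hB : ∀ u ∈ Icc R S, ‖-Complex.exp (-c * (u : ℂ) ^ 2) / c‖ ≤ 1 / ‖c‖ := fun u _ => by
    rw [norm_div, norm_neg]
    gcongr
    exact norm_cexp_neg_mul_sq_le hre u
  have hbound := norm_integral_smul_deriv_le hRS hp
    (fun u _ => neg_nonpos.2 (by positivity)) (by have := hR.trans_le hRS; positivity)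
    (fun u _ => hv u) (Continuous.intervalIntegrable (by fun_prop) _ _) hB
  have heq : ∫ u in R..S, (1 / (2 * u)) • (2 * (u : ℂ) * Complex.exp (-c * (u : ℂ) ^ 2)) =
      ∫ u in R..S, Complex.exp (-c * (u : ℂ) ^ 2) := intervalIntegral.integral_congr fun u hu => by
    rw [uIcc_of_le hRS] at hu
    have : (u : ℂ) ≠ 0 := Complex.ofReal_ne_zero.2 (hpos u hu)
    simp only [Complex.real_smul]
    push_cast
    field_simp
  rw [heq] at hbound
  refine hbound.trans_eq ?_
  field_simp

theorem norm_sub_integral_cexp_neg_mul_sq_le_of_re_pos (hre : 0 < c.re) {R : ℝ} (hR : 0 < R) :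
    ‖(π / c) ^ (1 / 2 : ℂ) / 2 - ∫ u in 0..R, Complex.exp (-c * (u : ℂ) ^ 2)‖ ≤ 1 / (‖c‖ * R) := by
  have hc : c ≠ 0 := fun h => by simp [h] at hre
  have hint (a b : ℝ) := (continuous_cexp_neg_mul_sq c).intervalIntegrable (μ := volume) a b
  rw [← integral_gaussian_complex_Ioi hre]
  refine le_of_tendsto ((intervalIntegral_tendsto_integral_Ioi 0
    (integrable_cexp_neg_mul_sq hre).integrableOn tendsto_id).sub_const _).norm ?_
  filter_upwards [eventually_ge_atTop R] with S hS
  rw [id, intervalIntegral.integral_interval_sub_left (hint _ _) (hint _ _)]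
  exact norm_integral_cexp_neg_mul_sq_le hre.le hc hR hS

theorem norm_sub_integral_cexp_neg_mul_sq_le (hre : 0 ≤ c.re) (hc : c ≠ 0) {R : ℝ} (hR : 0 < R) :
    ‖(π / c) ^ (1 / 2 : ℂ) / 2 - ∫ u in 0..R, Complex.exp (-c * (u : ℂ) ^ 2)‖ ≤ 1 / (‖c‖ * R) := by
  have hz : Tendsto (fun ε : ℝ => (ε : ℂ) + c) (𝓝[>] 0) (𝓝 c) :=
    tendsto_nhdsWithin_of_tendsto_nhds
      (Continuous.tendsto' (by fun_prop) 0 c (by rw [Complex.ofReal_zero, zero_add]))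
  have hre' : ∀ᶠ ε : ℝ in 𝓝[>] 0, 0 < ((ε : ℂ) + c).re := by
    filter_upwards [self_mem_nhdsWithin] with ε hε
    rw [Complex.add_re, Complex.ofReal_re]
    exact add_pos_of_pos_of_nonneg hε hre
  have hslit : (π : ℂ) / c ∈ Complex.slitPlane := by
    have hnormSq := Complex.normSq_pos.2 hc
    rw [Complex.mem_slitPlane_iff]
    rcases hre.lt_or_eq with hlt | heq
    · left
      simp only [Complex.div_re, Complex.ofReal_re, Complex.ofReal_im, zero_mul, zero_div, add_zero]
      positivity
    · have him : c.im ≠ 0 := fun him => hc (Complex.ext heq.symm him)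
      right
      simp [Complex.div_im, him, hc, pi_ne_zero]
  have hval := (((continuousAt_cpow_const (b := 1 / 2) hslit).tendsto).comp
    (tendsto_const_nhds.div hz hc)).div_const 2
  have hint : Tendsto (fun ε : ℝ => ∫ u in 0..R, Complex.exp (-(ε + c) * (u : ℂ) ^ 2)) (𝓝[>] 0)
      (𝓝 (∫ u in 0..R, Complex.exp (-c * (u : ℂ) ^ 2))) := by
    refine intervalIntegral.tendsto_integral_filter_of_dominated_convergence (fun _ => 1)
      (Eventually.of_forall fun ε => (continuous_cexp_neg_mul_sq _).aestronglyMeasurable) ?_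
      intervalIntegrable_const (ae_of_all _ fun u _ => (hz.neg.mul_const _).cexp)
    filter_upwards [hre'] with ε hε
    exact ae_of_all _ fun u _ => norm_cexp_neg_mul_sq_le hε.le u
  refine le_of_tendsto_of_tendsto (hval.sub hint).norm
    (tendsto_const_nhds.div (hz.norm.mul_const R) (by positivity)) ?_
  filter_upwards [hre'] with ε hε using norm_sub_integral_cexp_neg_mul_sq_le_of_re_pos hε hR

theorem tendsto_integral_cexp_neg_mul_sq (hre : 0 ≤ c.re) (hc : c ≠ 0) :
    Tendsto (fun R : ℝ => ∫ u in 0..R, Complex.exp (-c * (u : ℂ) ^ 2)) atTop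
      (𝓝 ((π / c) ^ (1 / 2 : ℂ) / 2)) := by
  refine tendsto_iff_norm_sub_tendsto_zero.2 (squeeze_zero' (Eventually.of_forall fun _ =>
    norm_nonneg _) ?_ (tendsto_const_nhds.div_atTop (tendsto_id.const_mul_atTop
      (norm_pos_iff.2 hc)) : Tendsto (fun R : ℝ => 1 / (‖c‖ * R)) atTop (𝓝 0)))
  filter_upwards [eventually_gt_atTop 0] with R hR
  rw [norm_sub_rev]
  exact norm_sub_integral_cexp_neg_mul_sq_le hre hc hR

theorem cpow_half_pi_div_I :
    ((π : ℂ) / Complex.I) ^ (1 / 2 : ℂ) = √π * Complex.exp (-(π / 4) * Complex.I) := by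
  have hsqrt : (√π : ℂ) = Complex.exp (1 / 2 * log π) := by
    rw [sqrt_eq_rpow, rpow_def_of_pos pi_pos, Complex.ofReal_exp]
    push_cast
    ring_nf
  rw [Complex.div_I, ← mul_neg, Complex.cpow_def_of_ne_zero (by simp [pi_ne_zero]),
    Complex.log_ofReal_mul pi_pos (by simp), Complex.log_neg_I, hsqrt, ← Complex.exp_add]
  ring_nf

end Gaussian

theorem exists_norm_le_of_tendsto_atTop {E : Type*} [NormedAddCommGroup E] {F : ℝ → E} {L : E}
    (hF : Continuous F) (hL : Tendsto F atTop (𝓝 L)) (a : ℝ) : ∃ C, ∀ x, a ≤ x → ‖F x‖ ≤ C := by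
  obtain ⟨b, hb⟩ := eventually_atTop.1
    (hL.norm.eventually (ge_mem_nhds (lt_add_one ‖L‖)))
  obtain ⟨C, hC⟩ := (isCompact_Icc (a := a) (b := b)).exists_bound_of_continuousOn hF.continuousOn
  refine ⟨max C (‖L‖ + 1), fun x hx => ?_⟩
  rcases le_total x b with hxb | hbx
  · exact (hC x ⟨hx, hxb⟩).trans (le_max_left _ _)
  · exact (hb x hbx).trans (le_max_right _ _)

theorem tendsto_integral_mul_comp_mul {F h : ℝ → ℂ} {L : ℂ} {T : ℝ} (hT : 0 ≤ T)
    (hF : Continuous F) (hL : Tendsto F atTop (𝓝 L)) (hh : IntervalIntegrable h volume 0 T) :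
    Tendsto (fun β : ℝ => ∫ w in 0..T, h w * F (β * w)) atTop (𝓝 (∫ w in 0..T, h w * L)) := by
  obtain ⟨C, hC⟩ := exists_norm_le_of_tendsto_atTop hF hL 0
  refine intervalIntegral.tendsto_integral_filter_of_dominated_convergence
    (fun w => ‖h w‖ * C) (Eventually.of_forall fun β => ?_) ?_ (hh.norm.mul_const C)
    (ae_of_all _ fun w hw => ?_)
  · exact hh.aestronglyMeasurable_restrict_uIoc.mul
      (Continuous.aestronglyMeasurable (by fun_prop))
  · filter_upwards [eventually_ge_atTop 0] with β hβ
    refine ae_of_all _ fun w hw => ?_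
    rw [uIoc_of_le hT] at hw
    rw [norm_mul]
    gcongr
    exact hC _ (mul_nonneg hβ hw.1.le)
  · rw [uIoc_of_le hT] at hw
    exact (hL.comp (tendsto_id.atTop_mul_const hw.1)).const_mul _

/-- Under the scaling, `e` concentrates at `0` with total mass `L`; it need not be integrable, so
integration by parts moves the limit to the primitive `F` of `e`. -/
theorem tendsto_mul_integral_scaled {e F q q' : ℝ → ℂ} {L : ℂ} {T : ℝ} (hT : 0 < T)
    (he : Continuous e) (hF : ∀ u, HasDerivAt F (e u) u) (hF0 : F 0 = 0)
    (hL : Tendsto F atTop (𝓝 L)) (hq : ContinuousOn q (Icc 0 T))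
    (hd : ∀ w ∈ Ioo 0 T, HasDerivAt q (q' w) w) (hq' : IntervalIntegrable q' volume 0 T) :
    Tendsto (fun β : ℝ => β * ∫ w in 0..T, q w * e (β * w)) atTop (𝓝 (q 0 * L)) := by
  have hFc : Continuous F := continuous_iff_continuousAt.2 fun u => (hF u).continuousAt
  rw [← uIcc_of_le hT.le] at hq
  have hparts (β : ℝ) : β * ∫ w in 0..T, q w * e (β * w) =
      q T * F (β * T) - ∫ w in 0..T, q' w * F (β * w) := by
    have hv (w : ℝ) : HasDerivAt (fun w => F (β * w)) (β * e (β * w)) w :=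
      ((hF _).scomp w ((hasDerivAt_id' w).const_mul β)).congr_deriv
        (by rw [mul_one, Complex.real_smul])
    have hparts := intervalIntegral.integral_mul_deriv_eq_deriv_mul_of_hasDerivAt hq
      (v := fun w => F (β * w)) (by fun_prop) (by rwa [min_eq_left hT.le, max_eq_right hT.le])
      (fun w _ => hv w) hq' (Continuous.intervalIntegrable (by fun_prop) _ _)
    simpa only [mul_zero, hF0, sub_zero, mul_left_comm _ (β : ℂ),
      intervalIntegral.integral_const_mul] using hparts
  have hend : Tendsto (fun β : ℝ => F (β * T)) atTop (𝓝 L) :=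
    hL.comp (tendsto_id.atTop_mul_const hT)
  have hdom := tendsto_integral_mul_comp_mul hT.le hFc hL hq'
  have hFTC : ∫ w in 0..T, q' w = q T - q 0 :=
    intervalIntegral.integral_eq_sub_of_hasDerivAt_of_le hT.le (by rwa [uIcc_of_le hT.le] at hq)
      hd hq'
  rw [intervalIntegral.integral_mul_const, hFTC] at hdom
  simp only [hparts]
  convert (hend.const_mul (q T)).sub hdom using 2
  ring

/-- The slope of `cosh` between `t - x` and `t`, extended by `sinh t` at `x = 0`. -/
def coshSlope (t x : ℝ) : ℝ :=
  dslope cosh t (t - x)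

theorem mul_coshSlope (t x : ℝ) : x * coshSlope t x = cosh t - cosh (t - x) := by
  have := sub_smul_dslope cosh t (t - x)
  rw [smul_eq_mul] at this
  rw [coshSlope]
  linarith

theorem coshSlope_zero (t : ℝ) : coshSlope t 0 = sinh t := by
  rw [coshSlope, sub_zero, dslope_same, (hasDerivAt_cosh t).deriv]

theorem continuous_coshSlope (t : ℝ) : Continuous (coshSlope t) := by
  have hdslope : Continuous (dslope cosh t) := by
    rw [← continuousOn_univ, continuousOn_dslope Filter.univ_mem]
    exact ⟨continuous_cosh.continuousOn, differentiableAt_cosh⟩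
  exact hdslope.comp (continuous_const.sub continuous_id)

theorem coshSlope_pos {t x : ℝ} (ht : 0 < t) (hx : x ∈ Icc 0 t) : 0 < coshSlope t x := by
  rcases hx.1.eq_or_lt with rfl | hpos
  · rw [coshSlope_zero]
    exact sinh_pos_iff.2 ht
  · have hcosh : cosh (t - x) < cosh t := by
      rw [cosh_lt_cosh, abs_of_nonneg (sub_nonneg.2 hx.2), abs_of_pos ht]
      linarith
    exact pos_of_mul_pos_right ((mul_coshSlope t x).symm ▸ sub_pos.2 hcosh) hpos.le

theorem hasDerivAt_coshSlope (t : ℝ) {x : ℝ} (hx : 0 < x) :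
    HasDerivAt (coshSlope t) ((sinh (t - x) - coshSlope t x) / x) x := by
  have hquot : HasDerivAt (fun y => (cosh t - cosh (t - y)) / y)
      ((sinh (t - x) - coshSlope t x) / x) x := by
    refine (((hasDerivAt_id' x).const_sub t).cosh.const_sub (cosh t) |>.fun_div
      (hasDerivAt_id' x) hx.ne').congr_deriv ?_
    rw [← mul_coshSlope]
    field_simp
  refine hquot.congr_of_eventuallyEq ?_
  filter_upwards [Ioi_mem_nhds hx] with y hy
  rw [← mul_coshSlope, mul_div_cancel_left₀ _ (ne_of_gt hy)]

theorem sinh_sub_le_coshSlope (t : ℝ) {x : ℝ} (hx : 0 < x) : sinh (t - x) ≤ coshSlope t x := by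
  obtain ⟨y, hy, hslope⟩ := exists_hasDerivAt_eq_slope cosh sinh (sub_lt_self t hx)
    continuous_cosh.continuousOn fun z _ => hasDerivAt_cosh z
  rw [sub_sub_cancel, ← mul_coshSlope, mul_div_cancel_left₀ _ hx.ne'] at hslope
  exact hslope ▸ sinh_le_sinh.2 hy.1.le

theorem exists_hasDerivAt_sqrt_two_div_coshSlope {t : ℝ} (ht : 0 < t) {w : ℝ}
    (hw : w ∈ Ioo 0 √t) :
    ∃ p', 0 ≤ p' ∧ HasDerivAt (fun w => √(2 / coshSlope t (w ^ 2))) p' w := by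
  have hw2 : 0 < w ^ 2 := pow_pos hw.1 2
  have hD := coshSlope_pos ht ⟨hw2.le, ((lt_sqrt hw.1.le).1 hw.2).le⟩
  have hD' : (sinh (t - w ^ 2) - coshSlope t (w ^ 2)) / w ^ 2 ≤ 0 :=
    div_nonpos_of_nonpos_of_nonneg (sub_nonpos.2 (sinh_sub_le_coshSlope t hw2)) hw2.le
  have hcomp : HasDerivAt (fun w => coshSlope t (w ^ 2))
      ((sinh (t - w ^ 2) - coshSlope t (w ^ 2)) / w ^ 2 * (2 * w)) w :=
    (HasDerivAt.comp w (h := fun w => w ^ 2) (hasDerivAt_coshSlope t hw2)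
      (hasDerivAt_pow 2 w)).congr_deriv (by simp)
  refine ⟨_, ?_, ((hasDerivAt_const w 2).fun_div hcomp hD.ne').sqrt (by positivity)⟩
  refine div_nonneg (div_nonneg ?_ (sq_nonneg _)) (by positivity)
  nlinarith [mul_nonneg (neg_nonneg.2 hD') hw.1.le]

theorem hasDerivAt_arccos_sinh_div_sinh {t : ℝ} {w : ℝ} (hw : w ∈ Ioo 0 √t) :
    HasDerivAt (fun w => arccos (sinh ((t - w ^ 2) / 2) / sinh (t / 2)))
      (√(2 / coshSlope t (w ^ 2)) * cosh ((t - w ^ 2) / 2)) w := by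
  have hw0 := hw.1
  have hwt : w ^ 2 < t := (lt_sqrt hw.1.le).1 hw.2
  have ht : 0 < t := (sq_nonneg w).trans_lt hwt
  have hD := coshSlope_pos ht ⟨(sq_nonneg w), hwt.le⟩
  have : 0 < sinh (t / 2) := sinh_pos_iff.2 (half_pos ht)
  have : 0 < sinh ((t - w ^ 2) / 2) := sinh_pos_iff.2 (half_pos (sub_pos.2 hwt))
  have hcosh (s : ℝ) : cosh s = 1 + 2 * sinh (s / 2) ^ 2 := by
    rw [← mul_div_cancel₀ s two_ne_zero, cosh_two_mul, cosh_sq]; ring_nf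
  have hsq : 1 - (sinh ((t - w ^ 2) / 2) / sinh (t / 2)) ^ 2 =
      (w / sinh (t / 2)) ^ 2 * (coshSlope t (w ^ 2) / 2) := by
    have := mul_coshSlope t (w ^ 2)
    rw [hcosh t, hcosh (t - w ^ 2)] at this
    field_simp
    linarith
  have hpos : 0 < 1 - (sinh ((t - w ^ 2) / 2) / sinh (t / 2)) ^ 2 := by rw [hsq]; positivity
  have hinner : HasDerivAt (fun w => sinh ((t - w ^ 2) / 2) / sinh (t / 2))
      (-(w * cosh ((t - w ^ 2) / 2) / sinh (t / 2))) w := by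
    refine ((((hasDerivAt_pow 2 w).const_sub t).div_const 2).sinh.div_const _).congr_deriv ?_
    push_cast
    ring
  refine ((hasDerivAt_arccos (fun h => by simp [h] at hpos) fun h => by simp [h] at hpos).comp w
    hinner).congr_deriv ?_
  rw [hsq, sqrt_mul (by positivity), sqrt_sq (by positivity), ← inv_div _ (2 : ℝ), sqrt_inv]
  field_simp

theorem cosMoment_zero_sinh_half (G : ℝ → ℝ) {t : ℝ} (ht : 0 < t) :
    cosMoment 0 G (sinh (t / 2)) = ∫ w in 0..√t,
      G (sinh ((t - w ^ 2) / 2)) * (√(2 / coshSlope t (w ^ 2)) * cosh ((t - w ^ 2) / 2)) := by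
  have hS : 0 < sinh (t / 2) := sinh_pos_iff.2 (half_pos ht)
  have hcov := intervalIntegral.integral_comp_mul_deriv_of_deriv_nonneg (a := 0) (b := √t)
    (f := fun w => arccos (sinh ((t - w ^ 2) / 2) / sinh (t / 2)))
    (g := fun θ => cos θ ^ 0 * G (sinh (t / 2) * cos θ))
    (by have := continuous_arccos; have := continuous_sinh; fun_prop)
    (by
      rw [min_eq_left (sqrt_nonneg t), max_eq_right (sqrt_nonneg t)]
      exact fun w hw => hasDerivAt_arccos_sinh_div_sinh hw)
    (fun w _ => by positivity)
  have hend : arccos (sinh ((t - 0 ^ 2) / 2) / sinh (t / 2)) = 0 := by simp [hS.ne']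
  have hend' : arccos (sinh ((t - √t ^ 2) / 2) / sinh (t / 2)) = π / 2 := by simp [sq_sqrt ht.le]
  rw [hend, hend'] at hcov
  refine hcov.symm.trans (intervalIntegral.integral_congr fun w hw => ?_)
  rw [uIcc_of_le (sqrt_nonneg t)] at hw
  have hwt : w ^ 2 ≤ t := (le_sqrt hw.1 ht.le).1 hw.2
  have : 0 ≤ sinh ((t - w ^ 2) / 2) := sinh_nonneg_iff.2 (by linarith)
  have hle : sinh ((t - w ^ 2) / 2) / sinh (t / 2) ≤ 1 :=
    (div_le_one hS).2 (sinh_le_sinh.2 (by linarith [sq_nonneg w]))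
  simp only [Function.comp_apply, pow_zero, one_mul]
  rw [cos_arccos (neg_one_lt_zero.le.trans (by positivity)) hle, mul_div_cancel₀ _ hS.ne']

theorem continuousOn_sqrt_two_div_coshSlope {t : ℝ} (ht : 0 < t) :
    ContinuousOn (fun w => √(2 / coshSlope t (w ^ 2))) (Icc 0 √t) := by
  have := continuous_coshSlope t
  refine (continuousOn_const.div (by fun_prop) fun w hw => ?_).sqrt
  exact (coshSlope_pos ht ⟨sq_nonneg w, (le_sqrt hw.1 ht.le).1 hw.2⟩).ne'

theorem tendsto_mul_integral_sqrt_coshSlope_mul_cexp {t : ℝ} (ht : 0 < t) :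
    Tendsto (fun β : ℝ => β * ∫ w in 0..√t,
        (√(2 / coshSlope t (w ^ 2)) : ℂ) * Complex.exp (-Complex.I * ((β * w : ℝ) : ℂ) ^ 2))
      atTop (𝓝 (√(2 / sinh t) * (√π * Complex.exp (-(π / 4) * Complex.I) / 2))) := by
  have hT : 0 < √t := sqrt_pos.2 ht
  have hcont := continuousOn_sqrt_two_div_coshSlope ht
  choose! p' hp' hd using fun w => exists_hasDerivAt_sqrt_two_div_coshSlope ht (w := w)
  have hint : IntervalIntegrable p' volume 0 √t :=
    intervalIntegral.intervalIntegrable_deriv_of_nonneg (by rwa [uIcc_of_le hT.le])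
      (by rwa [min_eq_left hT.le, max_eq_right hT.le])
      (by rwa [min_eq_left hT.le, max_eq_right hT.le])
  have hlim := tendsto_integral_cexp_neg_mul_sq (c := Complex.I) (by simp) Complex.I_ne_zero
  rw [cpow_half_pi_div_I] at hlim
  have hscaled := tendsto_mul_integral_scaled hT (continuous_cexp_neg_mul_sq Complex.I)
    (fun u => ((continuous_cexp_neg_mul_sq Complex.I).integral_hasStrictDerivAt 0 u).hasDerivAt)
    intervalIntegral.integral_same hlim
    (Complex.continuous_ofReal.comp_continuousOn hcont) (fun w hw => (hd w hw).ofReal_comp)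
    ⟨hint.1.ofReal, hint.2.ofReal⟩
  simpa only [Function.comp_apply, ne_eq, OfNat.ofNat_ne_zero, not_false_eq_true, zero_pow,
    coshSlope_zero] using hscaled

theorem cosMoment_planeKernel_eq_re (b : ℝ) {t : ℝ} (ht : 0 < t) :
    cosMoment 0 (planeKernel b) (sinh (t / 2)) =
      (Complex.exp ((b * t : ℝ) * Complex.I) * ∫ w in 0..√t, (√(2 / coshSlope t (w ^ 2)) : ℂ) *
        Complex.exp (-Complex.I * (b * (w : ℂ) ^ 2))).re := by
  have hint : IntervalIntegrable (fun w : ℝ => Complex.exp ((b * t : ℝ) * Complex.I) *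
      ((√(2 / coshSlope t (w ^ 2)) : ℂ) * Complex.exp (-Complex.I * (b * (w : ℂ) ^ 2))))
      volume 0 √t := by
    refine ContinuousOn.intervalIntegrable (continuousOn_const.mul (ContinuousOn.mul ?_ ?_))
    · rw [uIcc_of_le (sqrt_nonneg t)]
      exact Complex.continuous_ofReal.comp_continuousOn (continuousOn_sqrt_two_div_coshSlope ht)
    · fun_prop
  rw [cosMoment_zero_sinh_half _ ht, ← intervalIntegral.integral_const_mul, ← Complex.reCLM_apply,
    ← Complex.reCLM.intervalIntegral_comp_comm hint]
  refine intervalIntegral.integral_congr fun w _ => ?_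
  have hexp : Complex.exp ((b * t : ℝ) * Complex.I) *
      Complex.exp (-Complex.I * (b * (w : ℂ) ^ 2)) =
      Complex.exp ((b * (t - w ^ 2) : ℝ) * Complex.I) := by
    rw [← Complex.exp_add]
    push_cast
    ring_nf
  simp only [Complex.reCLM_apply]
  rw [mul_left_comm, planeKernel_sinh_mul_cosh, mul_left_comm, hexp, Complex.re_ofReal_mul,
    Complex.exp_ofReal_mul_I_re]
  ring_nf

theorem sqrt_two_div_pi_mul_mul_cos_eq_re {s : ℝ} (hs : 0 ≤ s) (x : ℝ) :
    √(2 / (π * s)) * cos (π / 4 - x) = 2 / π * (Complex.exp (x * Complex.I) *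
      (√(2 / s) * (√π * Complex.exp (-(π / 4) * Complex.I) / 2))).re := by
  have hexp : Complex.exp (x * Complex.I) *
      (√(2 / s) * (√π * Complex.exp (-(π / 4) * Complex.I) / 2)) =
      (√(2 / s) * √π / 2 : ℝ) * Complex.exp ((x - π / 4 : ℝ) * Complex.I) := by
    rw [Complex.ofReal_sub, sub_eq_add_neg, add_mul, Complex.exp_add]
    push_cast
    ring
  have hamp : √(2 / (π * s)) = 2 / π * (√(2 / s) * √π / 2) := by
    rw [mul_comm π, ← div_div, sqrt_div (by positivity)]
    have := sq_sqrt pi_pos.le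
    field_simp
    linear_combination -√(2 / s) * this
  rw [hexp, Complex.re_ofReal_mul, Complex.exp_ofReal_mul_I_re, hamp, ← cos_neg, neg_sub]
  ring

theorem tendsto_sqrt_mul_cosMoment_planeKernel_sub {t : ℝ} (ht : 0 < t) :
    Tendsto (fun b => √b * (2 / π * cosMoment 0 (planeKernel b) (sinh (t / 2))) -
      √(2 / (π * sinh t)) * cos (π / 4 - b * t)) atTop (𝓝 0) := by
  set V : ℂ := √(2 / sinh t) * (√π * Complex.exp (-(π / 4) * Complex.I) / 2)
  set X : ℝ → ℂ := fun b => √b * ∫ w in 0..√t, (√(2 / coshSlope t (w ^ 2)) : ℂ) *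
    Complex.exp (-Complex.I * ((√b * w : ℝ) : ℂ) ^ 2) with hX
  have hXV : Tendsto (fun b => 2 / π * ‖X b - V‖) atTop (𝓝 0) := by
    have h := (tendsto_iff_norm_sub_tendsto_zero.1
      ((tendsto_mul_integral_sqrt_coshSlope_mul_cexp ht).comp tendsto_sqrt_atTop)).const_mul (2 / π)
    rwa [mul_zero] at h
  refine squeeze_zero_norm' ?_ hXV
  filter_upwards [eventually_ge_atTop 0] with b hb
  have hre : √b * (2 / π * cosMoment 0 (planeKernel b) (sinh (t / 2))) =
      2 / π * (Complex.exp ((b * t : ℝ) * Complex.I) * X b).re := by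
    have hsq (w : ℝ) : ((√b * w : ℝ) : ℂ) ^ 2 = b * (w : ℂ) ^ 2 := by
      rw [← Complex.ofReal_pow, mul_pow, sq_sqrt hb, Complex.ofReal_mul, Complex.ofReal_pow]
    simp only [hX, hsq]
    rw [cosMoment_planeKernel_eq_re b ht, mul_left_comm (Complex.exp _), Complex.re_ofReal_mul]
    ring
  rw [hre, sqrt_two_div_pi_mul_mul_cos_eq_re (sinh_pos_iff.2 ht).le, ← mul_sub, ← Complex.sub_re,
    ← mul_sub, norm_mul, Real.norm_of_nonneg (by positivity)]
  gcongr
  refine (Complex.abs_re_le_norm _).trans_eq ?_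
  rw [norm_mul, Complex.norm_exp_ofReal_mul_I, one_mul]

theorem tendsto_sqrt_sub_sqrt (c : ℝ) :
    Tendsto (fun x => √x - √(x - c)) atTop (𝓝 0) := by
  refine squeeze_zero_norm' ?_ (tendsto_const_nhds (x := |c|).div_atTop tendsto_sqrt_atTop)
  filter_upwards [eventually_gt_atTop 0, eventually_ge_atTop c] with x hx hc
  have hsq := sq_sqrt hx.le
  have hsq' := sq_sqrt (sub_nonneg.2 hc)
  rw [le_div_iff₀ (sqrt_pos.2 hx)]
  calc ‖√x - √(x - c)‖ * √x ≤ |√x - √(x - c)| * |√x + √(x - c)| := by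
        rw [norm_eq_abs, abs_of_nonneg (by positivity : 0 ≤ √x + √(x - c))]
        gcongr
        exact le_add_of_nonneg_right (sqrt_nonneg _)
    _ = |c| := by
        rw [← abs_mul]
        congr 1
        linear_combination hsq - hsq'

theorem tendsto_sqrt_sub_atTop (c : ℝ) : Tendsto (fun x => √(x - c)) atTop atTop :=
  tendsto_sqrt_atTop.comp (tendsto_atTop_add_const_right _ _ tendsto_id)

theorem tendsto_rpow_mul_sub_of_tendsto_sub {α : Type*} {l : Filter α} {F T : ℝ → ℝ} {p M : ℝ}
    (hlim : Tendsto (fun b => b ^ p * F b - T b) atTop (𝓝 0)) (hT : UniformContinuous T)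
    (hM : ∀ b, |T b| ≤ M) {x y : α → ℝ} (hx : Tendsto x l atTop)
    (hyx : Tendsto (fun i => y i - x i) l (𝓝 0)) :
    Tendsto (fun i => y i ^ p * F (x i) - T (y i)) l (𝓝 0) := by
  have hy : Tendsto y l atTop := by
    simpa only [add_sub_cancel] using hx.atTop_add hyx
  have hratio : Tendsto (fun i => y i / x i) l (𝓝 1) := by
    have h := (hyx.div_atTop hx).const_add 1
    rw [add_zero] at h
    refine h.congr' ?_
    filter_upwards [hx.eventually_gt_atTop 0] with i hi
    field_simp
    ring
  have hpow : Tendsto (fun i => (y i / x i) ^ p) l (𝓝 1) := by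
    simpa only [one_rpow] using hratio.rpow_const (Or.inl one_ne_zero)
  have hmain := hpow.mul (hlim.comp hx)
  have herror := (tendsto_sub_nhds_zero_iff.2 hpow).zero_mul_isBoundedUnder_le
    (isBoundedUnder_of ⟨M, fun i => hM (x i)⟩ : IsBoundedUnder (· ≤ ·) l (norm ∘ fun i => T (x i)))
  have hosc : Tendsto (fun i => T (y i) - T (x i)) l (𝓝 0) := by
    have hclose : Tendsto (fun i => (y i, x i)) l (uniformity ℝ) :=
      tendsto_uniformity_iff_dist_tendsto_zero.2 (tendsto_zero_iff_norm_tendsto_zero.1 hyx)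
    exact tendsto_zero_iff_norm_tendsto_zero.2
      (tendsto_uniformity_iff_dist_tendsto_zero.1 (Tendsto.comp hT hclose))
  have h := (hmain.add herror).sub hosc
  simp only [mul_zero, add_zero, sub_zero] at h
  refine h.congr' ?_
  filter_upwards [hx.eventually_gt_atTop 0, hy.eventually_gt_atTop 0] with i hxi hyi
  have := (rpow_pos_of_pos hxi p).ne'
  rw [div_rpow hyi.le hxi.le]
  simp only [Function.comp_apply]
  field_simp
  ring

theorem uniformContinuous_const_mul_cos_sub (A θ t : ℝ) :
    UniformContinuous fun b => A * cos (θ - b * t) := by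
  have hphase : UniformContinuous fun b => θ - b * t :=
    uniformContinuous_const.sub (uniformContinuous_id.mul_const' t)
  exact (lipschitzWith_cos.uniformContinuous.comp hphase).const_mul' A

theorem abs_const_mul_cos_le (A x : ℝ) : |A * cos x| ≤ |A| := by
  rw [abs_mul]
  exact mul_le_of_le_one_right (abs_nonneg A) (abs_cos_le_one x)

theorem sqrt_mul_sq_rpow {x y : ℝ} (hx : 0 ≤ x) (hy : 0 ≤ y) (p : ℝ) :
    √(x * y ^ 2) ^ (2 * p) = x ^ p * y ^ (2 * p) := by
  rw [sqrt_eq_rpow, ← rpow_mul (by positivity), one_div, inv_mul_cancel_left₀ two_ne_zero,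
    mul_rpow hx (sq_nonneg y), rpow_mul hy, rpow_two]

theorem isLittleO_one_div_of_tendsto {α : Type*} {l : Filter α} {g s : α → ℝ}
    (hs : ∀ᶠ x in l, s x ≠ 0) (h : Tendsto (fun x => s x * g x) l (𝓝 0)) :
    g =o[l] fun x => 1 / s x := by
  refine (isLittleO_iff_tendsto' ?_).2 (h.congr fun x => ?_)
  · filter_upwards [hs] with x hx hzero
    exact absurd hzero (one_div_ne_zero hx)
  · rw [div_div_eq_mul_div, div_one, mul_comm]

theorem tendsto_sq_mul_sub_cos {t : ℝ} (ht : 0 < t) :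
    Tendsto (fun b => b ^ 2 *
      (3 * (sin (b * t) * cosh t - b * cos (b * t) * sinh t) / (b * (1 + b ^ 2) * sinh t ^ 3)) -
        -(3 / sinh t ^ 2) * cos (b * t)) atTop (𝓝 0) := by
  have := sinh_pos_iff.2 ht
  have hbound : Tendsto (fun b : ℝ => (3 * cosh t / sinh t ^ 3 + 3 / sinh t ^ 2) / b)
      atTop (𝓝 0) := tendsto_const_nhds.div_atTop tendsto_id
  refine squeeze_zero_norm' ?_ hbound
  filter_upwards [eventually_ge_atTop 1] with b hb
  have hb0 : 0 < b := by linarith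
  have hsplit : b ^ 2 * (3 * (sin (b * t) * cosh t - b * cos (b * t) * sinh t) /
      (b * (1 + b ^ 2) * sinh t ^ 3)) - -(3 / sinh t ^ 2) * cos (b * t) =
      3 * cosh t / sinh t ^ 3 * (b / (1 + b ^ 2)) * sin (b * t) +
        3 / sinh t ^ 2 * (1 / (1 + b ^ 2)) * cos (b * t) := by
    field_simp
    ring
  have hquot : b / (1 + b ^ 2) ≤ 1 / b := by
    rw [div_le_div_iff₀ (by positivity) hb0]
    linarith [sq b]
  have hinv : 1 / (1 + b ^ 2) ≤ 1 / b := one_div_le_one_div_of_le hb0 (by nlinarith)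
  have := cosh_pos t
  rw [hsplit, norm_eq_abs]
  calc _ ≤ 3 * cosh t / sinh t ^ 3 * (b / (1 + b ^ 2)) * 1 +
        3 / sinh t ^ 2 * (1 / (1 + b ^ 2)) * 1 := by
        refine (abs_add_le _ _).trans (add_le_add ?_ ?_) <;>
          rw [abs_mul, abs_of_nonneg (by positivity)] <;> gcongr
        exacts [abs_sin_le_one _, abs_cos_le_one _]
    _ ≤ 3 * cosh t / sinh t ^ 3 * (1 / b) * 1 + 3 / sinh t ^ 2 * (1 / b) * 1 := by gcongr
    _ = _ := by ring

namespace IsRadialEigenfunction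

variable {k : ℕ} {ρ r : ℝ}

theorem hasDerivAt {lam : ℂ} {φ : ℝ → ℂ} (h : IsRadialEigenfunction k ρ lam φ) (hr : 0 < r) :
    HasDerivAt φ (deriv φ r) r :=
  ((h.contDiffOn.differentiableOn two_ne_zero).differentiableAt (Ioi_mem_nhds hr)).hasDerivAt

theorem hasDerivAt_deriv {lam : ℂ} {φ : ℝ → ℂ} (h : IsRadialEigenfunction k ρ lam φ)
    (hr : 0 < r) :
    HasDerivAt (deriv φ)
      (-(k / ρ * (cosh (r / ρ) / sinh (r / ρ)) : ℝ) * deriv φ r - lam * φ r) r := by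
  have hderiv : ContDiffOn ℝ 1 (deriv φ) (Ioi 0) :=
    ((contDiffOn_succ_iff_deriv_of_isOpen (n := 1) isOpen_Ioi).1 h.contDiffOn).2.2
  refine ((hderiv.differentiableOn one_ne_zero).differentiableAt
    (Ioi_mem_nhds hr)).hasDerivAt.congr_deriv ?_
  have heigen := h.eigen r hr
  unfold hyperbolicRadialLaplacian at heigen
  linear_combination heigen

theorem tendsto {lam : ℂ} {φ : ℝ → ℂ} (h : IsRadialEigenfunction k ρ lam φ) :
    Tendsto φ (𝓝[>] 0) (𝓝 1) := by
  have hcont := h.continuousOn 0 self_mem_Ici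
  rw [ContinuousWithinAt, h.map_zero] at hcont
  exact hcont.mono_left (nhdsWithin_mono _ Ioi_subset_Ici_self)

theorem isRadialSolution {lam : ℝ} {φ : ℝ → ℂ} (h : IsRadialEigenfunction k ρ lam φ) (hρ : 0 < ρ)
    (L : ℂ →L[ℝ] ℝ) :
    IsRadialSolution k (lam * ρ ^ 2) (fun t => L (φ (ρ * t))) (fun t => ρ * L (deriv φ (ρ * t)))
      (L 1) where
  hasDerivAt t ht := by
    have hcomp := (h.hasDerivAt (mul_pos hρ ht)).scomp t ((hasDerivAt_id t).const_mul ρ)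
    refine (L.hasFDerivAt.comp_hasDerivAt t hcomp).congr_deriv ?_
    rw [mul_one, map_smul, smul_eq_mul]
  hasDerivAt_deriv t ht := by
    have hcomp := (h.hasDerivAt_deriv (mul_pos hρ ht)).scomp t ((hasDerivAt_id t).const_mul ρ)
    refine ((L.hasFDerivAt.comp_hasDerivAt t hcomp).const_mul ρ).congr_deriv ?_
    have hL (x : ℝ) (z : ℂ) : L (x * z) = x * L z := by
      rw [← Complex.real_smul, map_smul, smul_eq_mul]
    rw [mul_div_cancel_left₀ t hρ.ne', mul_one, map_smul, map_sub, ← Complex.ofReal_neg, hL, hL,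
      smul_eq_mul]
    field_simp
  tendsto := (L.continuous.tendsto 1).comp (h.tendsto.comp (tendsto_const_mul_nhdsGT_zero hρ))

theorem im_eq_zero {lam : ℝ} {φ : ℝ → ℂ} (h : IsRadialEigenfunction k ρ lam φ) (hρ : 0 < ρ)
    (hk : 1 ≤ k) (hlam : 0 < lam) (hr : 0 < r) : (φ r).im = 0 := by
  have him := (h.isRadialSolution hρ Complex.imCLM).sq_le hk (by positivity) (div_pos hr hρ)
  rw [mul_div_cancel₀ r hρ.ne'] at him
  simpa [sq_nonpos_iff] using him

theorem eq_ofReal {lam : ℝ} {φ : ℝ → ℂ} {g g' : ℝ → ℝ} (h : IsRadialEigenfunction k ρ lam φ)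
    (hρ : 0 < ρ) (hk : 1 ≤ k) (hlam : 0 < lam) (hg : IsRadialSolution k (lam * ρ ^ 2) g g' 1)
    (hr : 0 < r) : φ r = g (r / ρ) := by
  have hre := (h.isRadialSolution hρ Complex.reCLM).unique hg hk (by positivity) (div_pos hr hρ)
  rw [mul_div_cancel₀ r hρ.ne', Complex.reCLM_apply] at hre
  exact Complex.ext hre (h.im_eq_zero hρ hk hlam hr)

theorem eq_sin_div {lam : ℝ} {φ : ℝ → ℂ} (h : IsRadialEigenfunction 2 ρ lam φ) (hρ : 0 < ρ)
    (hlam : 1 / ρ ^ 2 < lam) (hr : 0 < r) :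
    φ r = (sin (√(lam * ρ ^ 2 - 1) * r / ρ) / (√(lam * ρ ^ 2 - 1) * sinh (r / ρ)) : ℝ) := by
  have hΛ : 0 < lam * ρ ^ 2 - 1 := sub_pos.2 ((div_lt_iff₀ (by positivity)).1 hlam)
  have hsol := isRadialSolution_two (sqrt_pos.2 hΛ).ne'
  rw [sq_sqrt hΛ.le, add_sub_cancel] at hsol
  rw [h.eq_ofReal hρ one_le_two ((by positivity : 0 < 1 / ρ ^ 2).trans hlam) hsol hr, mul_div_assoc]

variable {φ : ℝ → ℝ → ℂ}

theorem isLittleO_sub_cos (hφ : ∀ lam : ℝ, IsRadialEigenfunction k ρ lam (φ lam)) (hρ : 0 < ρ)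
    (hk : 1 ≤ k) (hr : 0 < r) {f : ℝ → ℝ → ℝ} {c p A θ : ℝ}
    (hf : ∀ b, b ≠ 0 → ∃ f', IsRadialSolution k (c + b ^ 2) (f b) f' 1)
    (hlim : Tendsto (fun b => b ^ (2 * p) * f b (r / ρ) - A * cos (θ - b * (r / ρ)))
      atTop (𝓝 0)) :
    (fun lam => φ lam r - (A / ρ ^ (2 * p) * (cos (θ - r * √lam) / lam ^ p) : ℝ)) =o[atTop]
      fun lam => 1 / lam ^ p := by
  have hscale : Tendsto (fun lam : ℝ => lam * ρ ^ 2) atTop atTop :=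
    tendsto_id.atTop_mul_const (by positivity)
  have hfreq := (tendsto_sqrt_sub_atTop c).comp hscale
  have htransfer := tendsto_rpow_mul_sub_of_tendsto_sub hlim
    (uniformContinuous_const_mul_cos_sub A θ (r / ρ)) (fun _ => abs_const_mul_cos_le A _) hfreq
    ((tendsto_sqrt_sub_sqrt c).comp hscale)
  have hreal : (fun lam => f √(lam * ρ ^ 2 - c) (r / ρ) -
      A / ρ ^ (2 * p) * (cos (θ - r * √lam) / lam ^ p)) =o[atTop] fun lam => 1 / lam ^ p := by
    refine isLittleO_one_div_of_tendsto ?_ ?_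
    · filter_upwards [eventually_gt_atTop 0] with lam hlam using (rpow_pos_of_pos hlam p).ne'
    · have h := htransfer.div_const (ρ ^ (2 * p))
      rw [zero_div] at h
      refine h.congr' ?_
      filter_upwards [eventually_gt_atTop 0] with lam hlam
      have := rpow_pos_of_pos hρ (2 * p)
      have := rpow_pos_of_pos hlam p
      have hphase : √(lam * ρ ^ 2) * (r / ρ) = r * √lam := by
        rw [sqrt_mul hlam.le, sqrt_sq hρ.le]
        field_simp
      simp only [Function.comp_apply]
      rw [sqrt_mul_sq_rpow hlam.le hρ.le, hphase]
      field_simp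
  refine (Complex.isLittleO_ofReal_left.2 hreal).congr' ?_ EventuallyEq.rfl
  filter_upwards [eventually_gt_atTop 0, hfreq.eventually_gt_atTop 0] with lam hlam hb
  obtain ⟨f', hsol⟩ := hf _ hb.ne'
  simp only [Function.comp_apply] at hb hsol
  rw [sq_sqrt (sqrt_pos.1 hb).le, add_sub_cancel] at hsol
  rw [(hφ lam).eq_ofReal hρ hk hlam hsol hr, Complex.ofReal_sub]

theorem isLittleO_one_div_sqrt (hφ : ∀ lam : ℝ, IsRadialEigenfunction k ρ lam (φ lam))
    (hρ : 0 < ρ) (hk : 3 ≤ k) (hr : 0 < r) :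
    (fun lam => φ lam r) =o[atTop] fun lam => 1 / √lam := by
  obtain ⟨m, hm, rfl⟩ : ∃ m, m ≠ 0 ∧ k = m + 2 := ⟨k - 2, by omega, by omega⟩
  have hρ2 : ρ ^ 2 ≠ 0 := by positivity
  have hsol (Λ : ℝ) (_ : 0 < Λ) := (hφ (Λ / ρ ^ 2)).isRadialSolution hρ Complex.reCLM
  simp only [div_mul_cancel₀ _ hρ2, Complex.reCLM_apply, Complex.one_re] at hsol
  have hdecay := ((IsRadialSolution.tendsto_sqrt_mul hsol hm (div_pos hr hρ)).comp
    (tendsto_id.atTop_mul_const (by positivity : 0 < ρ ^ 2))).div_const ρ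
  simp only [zero_div] at hdecay
  have hreal : (fun lam => (φ lam r).re) =o[atTop] fun lam => 1 / √lam := by
    refine isLittleO_one_div_of_tendsto ?_ (hdecay.congr' ?_)
    · filter_upwards [eventually_gt_atTop 0] with lam hlam using (sqrt_pos.2 hlam).ne'
    · filter_upwards [eventually_gt_atTop 0] with lam hlam
      simp only [Function.comp_apply, id_eq, mul_div_cancel_right₀ lam hρ2,
        mul_div_cancel₀ r hρ.ne']
      rw [sqrt_mul hlam.le, sqrt_sq hρ.le]
      field_simp
  refine (Complex.isLittleO_ofReal_left.2 hreal).congr' ?_ EventuallyEq.rfl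
  filter_upwards [eventually_gt_atTop 0] with lam hlam
  exact Complex.ext rfl ((hφ lam).im_eq_zero hρ (by omega) hlam hr).symm

theorem isLittleO_sub_of_one (hφ : ∀ lam : ℝ, IsRadialEigenfunction 1 ρ lam (φ lam))
    (hρ : 0 < ρ) (hr : 0 < r) :
    (fun lam => φ lam r - (√(2 / (π * ρ * sinh (r / ρ))) *
      (cos (π / 4 - r * √lam) / lam ^ (1 / 4 : ℝ)) : ℝ)) =o[atTop]
      fun lam => 1 / lam ^ (1 / 4 : ℝ) := by
  have hexp : 2 * (1 / 4 : ℝ) = 1 / 2 := by norm_num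
  have hamp : √(2 / (π * sinh (r / ρ))) / ρ ^ (2 * (1 / 4) : ℝ) =
      √(2 / (π * ρ * sinh (r / ρ))) := by
    rw [hexp, ← sqrt_eq_rpow, ← sqrt_div' _ hρ.le]
    congr 1
    field_simp
  rw [← hamp]
  exact isLittleO_sub_cos hφ hρ le_rfl hr (fun b _ => isRadialSolution_one b)
    (by simpa only [hexp, ← sqrt_eq_rpow] using
      tendsto_sqrt_mul_cosMoment_planeKernel_sub (div_pos hr hρ))

theorem isLittleO_sub_of_two (hφ : ∀ lam : ℝ, IsRadialEigenfunction 2 ρ lam (φ lam))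
    (hρ : 0 < ρ) (hr : 0 < r) :
    (fun lam => φ lam r - (1 / (ρ * sinh (r / ρ)) * (sin (r * √lam) / √lam) : ℝ)) =o[atTop]
      fun lam => 1 / √lam := by
  have hlim : Tendsto (fun b => b ^ (2 * (1 / 2) : ℝ) *
      (sin (b * (r / ρ)) / (b * sinh (r / ρ))) -
        1 / sinh (r / ρ) * cos (π / 2 - b * (r / ρ))) atTop (𝓝 0) := by
    refine tendsto_const_nhds.congr' ?_
    filter_upwards [eventually_gt_atTop 0] with b hb
    rw [mul_one_div_cancel two_ne_zero, rpow_one, cos_pi_div_two_sub]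
    field_simp
    ring
  have h := isLittleO_sub_cos hφ hρ one_le_two hr (fun b hb => ⟨_, isRadialSolution_two hb⟩) hlim
  simpa only [mul_one_div_cancel (two_ne_zero' ℝ), rpow_one, ← sqrt_eq_rpow, cos_pi_div_two_sub,
    div_div, mul_comm (sinh _)] using h

theorem isLittleO_sub_of_four (hφ : ∀ lam : ℝ, IsRadialEigenfunction 4 ρ lam (φ lam))
    (hρ : 0 < ρ) (hr : 0 < r) :
    (fun lam => φ lam r - (-((√3 / (ρ * sinh (r / ρ))) ^ 2) * (cos (r * √lam) / lam) : ℝ))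
      =o[atTop] fun lam => 1 / lam := by
  have hlim := tendsto_sq_mul_sub_cos (div_pos hr hρ)
  have h := isLittleO_sub_cos (p := 1) (θ := 0) (A := -(3 / sinh (r / ρ) ^ 2)) hφ hρ
    (by norm_num) hr (fun b hb => isRadialSolution_four hb)
    (by simpa only [mul_one, rpow_two, zero_sub, cos_neg])
  have hamp : -(3 / sinh (r / ρ) ^ 2) / ρ ^ 2 = -((√3 / (ρ * sinh (r / ρ))) ^ 2) := by
    rw [div_pow, sq_sqrt zero_le_three, mul_pow]
    field_simp
  simpa only [mul_one, rpow_two, rpow_one, zero_sub, cos_neg, hamp] using h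

end IsRadialEigenfunction

end

theorem mainTheorem10 (k : ℕ) (ρ : ℝ) (hρ : 0 < ρ)
    (φ : ℝ → ℝ → ℂ) (hφ : ∀ lam : ℝ, IsRadialEigenfunction k ρ (lam : ℂ) (φ lam))
    (r : ℝ) (hr : 0 < r) :
    (k = 1 →
      (fun lam : ℝ => φ lam r -
          ((Real.sqrt (2 / (Real.pi * ρ * Real.sinh (r / ρ))) *
            (Real.cos (Real.pi / 4 - r * Real.sqrt lam) / lam ^ (1 / 4 : ℝ)) : ℝ) : ℂ))
        =o[atTop] (fun lam : ℝ => 1 / lam ^ (1 / 4 : ℝ))) ∧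
    (k = 2 →
      (∀ lam : ℝ, 1 / ρ ^ 2 < lam →
        φ lam r =
          ((Real.sin (Real.sqrt (lam * ρ ^ 2 - 1) * r / ρ) /
            (Real.sqrt (lam * ρ ^ 2 - 1) * Real.sinh (r / ρ)) : ℝ) : ℂ)) ∧
      (fun lam : ℝ => φ lam r -
          ((1 / (ρ * Real.sinh (r / ρ)) *
            (Real.sin (r * Real.sqrt lam) / Real.sqrt lam) : ℝ) : ℂ))
        =o[atTop] (fun lam : ℝ => 1 / Real.sqrt lam)) ∧
    (3 ≤ k →
      (fun lam : ℝ => φ lam r) =o[atTop] (fun lam : ℝ => 1 / Real.sqrt lam)) ∧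
    (k = 4 →
      (fun lam : ℝ => φ lam r -
          ((-((Real.sqrt 3 / (ρ * Real.sinh (r / ρ))) ^ 2) *
            (Real.cos (r * Real.sqrt lam) / lam) : ℝ) : ℂ))
        =o[atTop] (fun lam : ℝ => 1 / lam)) := by
  refine ⟨?_, ?_, ?_, ?_⟩
  · rintro rfl
    exact IsRadialEigenfunction.isLittleO_sub_of_one hφ hρ hr
  · rintro rfl
    exact ⟨fun lam hlam => (hφ lam).eq_sin_div hρ hlam hr,
      IsRadialEigenfunction.isLittleO_sub_of_two hφ hρ hr⟩
  · intro hk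
    exact IsRadialEigenfunction.isLittleO_one_div_sqrt hφ hρ hk hr
  · rintro rfl
    exact IsRadialEigenfunction.isLittleO_sub_of_four hφ hρ hr
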